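/- Let $k$ be a field and let $P$ be the commutative ladder of length $n$: the poset with elements $x_1,\dots,x_n,y_1,\dots,y_n$, where $x_i=(i,1)$ and $y_i=(i,2)$, ordered by $(i,s)\le(j,t)$ iff $i\le j$ and $s\le t$. Let $A$ be its incidence algebra over $k$; finite-dimensional $A$-modules are identified with functors from $P$ to finite-dimensional $k$-vector spaces. Let $\mathbb I$ be the set of intervals of $P$, i.e. the nonempty convex subsets that are connected as full subgraphs of the Hasse diagram, ordered by inclusion. For $I\in\mathbb I$ let $V_I$ be the interval module with support $I$ ($k$ at the points of $I$, $0$ elsewhere, with identity maps between points of $I$), let $G=\bigoplus_{I\in\mathbb I}V_I$, and let $\mathcal I=\operatorname{add}G$ be the class of direct summands of finite direct sums of copies of $G$. A right $\mathcal I$-approximation of a module $N$ is a morphism $f\colon X\to N$ with $X\in\mathcal I$ such that every morphism $Y\to N$ with $Y\in\mathcal I$ factors through $f$. An interval resolution of a finite-dimensional $A$-module $M$ is a complex $$0\to\bigoplus_{J\in\mathbb I}V_J^{d_J^{(r)}}\xrightarrow{f_r}\cdots\xrightarrow{f_1}\bigoplus_{J\in\mathbb I}V_J^{d_J^{(0)}}\xrightarrow{f_0}M\to0$$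 such that $f_0$ is a right $\mathcal I$-approximation of $M$ and, for every $i\ge1$, $f_i$ is a right $\mathcal I$-approximation of $\operatorname{Ker}f_{i-1}$ (where $f_i$ is the zero map from the zero module for $i>r$). Let $Q'$ be the quiver $1\xleftarrow{\alpha_1}2\xrightarrow{\alpha_2}3\xleftarrow{\alpha_3}4\xrightarrow{\alpha_4}5$. For $I\in\mathbb I$ whose lower row, if nonempty, is $x_i,\dots,x_j$ and whose upper row, if nonempty, is $y_k,\dots,y_l$, let $\xi_I$ send the vertices $1,2,3,4,5$ of $Q'$ to $$\begin{cases}y_l,\,y_k,\,y_i,\,x_i,\,x_j&\text{if } I \text{ meets both rows},\\ x_j,\,x_i,\,x_i,\,x_i,\,x_j&\text{if } I \text{ lies in the lower row},\\ y_l,\,y_k,\,y_k,\,y_k,\,y_l&\text{if } I \text{ lies in the upper row},\end{cases}$$ and each arrow to the unique morphism of the category $P$ between the images of its ends. Let $R_I(M)$ be the representation of $Q'$ obtained by composing $M$ with $\xi_I$, and let the compressed multiplicity $c^\xi_M(I)$ be the multiplicity of the indecomposable representation $R_I(V_I)$ as a direct summand of $R_I(M)$. For $J\in\mathbb I$ let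 $\operatorname{cov}(J)$ be the set of elements of $\mathbb I$ covering $J$, and put $$\delta^\xi_M(J)=\sum_{S\subseteq\operatorname{cov}(J)}(-1)^{\#S}\,c^\xi_M\Bigl(\bigvee S\Bigr),$$ where $\bigvee S$ is the join of $S$ in $\mathbb I$ if $S\neq\emptyset$, and $\bigvee\emptyset:=J$. **Corollary.** Let $M$ be a finite-dimensional $A$-module with an interval resolution as above, and let $J\in\mathbb I$. Then the join $\bigvee S$ exists in $\mathbb I$ for every nonempty $S\subseteq\operatorname{cov}(J)$, and $$\delta^\xi_M(J)=\sum_{i=0}^r(-1)^i\,d_J^{(i)}.$$ -/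

import Mathlib

open CategoryTheory CategoryTheory.Limits

universe u

noncomputable section

attribute [local instance] Abelian.hasFiniteBiproducts

/-! ### The commutative ladder and its intervals -/

/-- The commutative ladder of length `n`, as a poset with the componentwise order.
In zero-based indexing, `(i, 0)` is the `i`-th vertex `x_i` of the lower row and
`(i, 1)` is the `i`-th vertex `y_i` of the upper row. -/
def Ladder (n : ℕ) : Type := Fin n × Fin 2

instance (n : ℕ) : PartialOrder (Ladder n) := inferInstanceAs (PartialOrder (Fin n × Fin 2))

instance (n : ℕ) : Finite (Ladder n) := inferInstanceAs (Finite (Fin n × Fin 2))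

/-- The vertex of the ladder at position `i` in row `t`. -/
abbrev Ladder.mk {n : ℕ} (i : Fin n) (t : Fin 2) : Ladder n := (i, t)

theorem Ladder.mk_le_mk {n : ℕ} {i j : Fin n} {s t : Fin 2} (h : i ≤ j) (h' : s ≤ t) :
    Ladder.mk i s ≤ Ladder.mk j t := Prod.mk_le_mk.2 ⟨h, h'⟩

/-- The intervals of the ladder: the convex subsets that are connected (in particular nonempty)
as full subgraphs of the Hasse diagram. They are ordered by inclusion. -/
abbrev LadderInterval (n : ℕ) : Type :=
  {S : Set (Ladder n) // S.OrdConnected ∧ ((SimpleGraph.hasse (Ladder n)).induce S).Connected}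

/-- `cov(J)`: the set of intervals covering `J` in the poset of intervals. -/
def intervalCovers {n : ℕ} (J : LadderInterval n) :
    Finset (LadderInterval n) :=
  (Set.toFinite {K : LadderInterval n | J ⋖ K}).toFinset

open Classical in
/-- The join `⋁ S` in the poset of intervals of a set `S` of covers of `J`,
where the empty join is `J` by convention. (The value `J` for a nonempty `S` without a join
is a default that is never used for `S ⊆ cov(J)`.) -/
def intervalJoin {n : ℕ} (J : LadderInterval n)
    (S : Finset (LadderInterval n)) : LadderInterval n :=
  if h : S.Nonempty ∧ ∃ K, IsLUB (S : Set (LadderInterval n)) K then h.2.choose else J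

/-! ### Modules as functors into finite-dimensional vector spaces -/

section General

variable {C : Type u} [Category* C] [Abelian C]

/-- `Y` is (isomorphic to) a direct summand of `X`. -/
def IsDirectSummand (Y X : C) : Prop :=
  ∃ Z : C, Nonempty (X ≅ Y ⊞ Z)

/-- The multiplicity `d_X(L)` of an indecomposable object `L` as a direct summand of `X`:
the largest `d` such that the direct sum of `d` copies of `L` is a direct summand of `X`. -/
def summandMult (L X : C) : ℕ :=
  sSup {d : ℕ | IsDirectSummand (⨁ fun _ : Fin d => L) X}

end General

section IntervalModules

variable (k : Type u) [Field k] {n : ℕ}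

/-- The finite-dimensional modules over the commutative ladder algebra, seen as functors from
the ladder poset to finite-dimensional vector spaces (persistence modules). -/
abbrev LadderMod (k : Type u) [Field k] (n : ℕ) :=
  Ladder n ⥤ FGModuleCat.{u} k

open Classical in
/-- The space of `V_I` at `p`: all of `k` if `p ∈ I`, and `0` otherwise. -/
def intervalSpace (I : LadderInterval n) (p : Ladder n) : Submodule k k :=
  if p ∈ I.1 then (⊤ : Submodule k k) else (⊥ : Submodule k k)

open Classical in
/-- The structure map of `V_I` from any point to `q`: the identity of `k` restricted to
the spaces of `V_I` if `q ∈ I`, and `0` otherwise. -/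
def intervalMap (I : LadderInterval n) (p q : Ladder n) :
    intervalSpace k I p →ₗ[k] intervalSpace k I q :=
  LinearMap.restrict (if q ∈ I.1 then LinearMap.id else 0 : k →ₗ[k] k) (by
    intro x _
    by_cases hq : q ∈ I.1
    · rw [intervalSpace, if_pos hq]
      exact Submodule.mem_top
    · rw [if_neg hq]
      exact Submodule.zero_mem _)

theorem intervalMap_id (I : LadderInterval n) (p : Ladder n) :
    intervalMap k I p p = LinearMap.id := by
  refine LinearMap.ext fun x => Subtype.ext ?_
  obtain ⟨x, hx⟩ := x
  by_cases hp : p ∈ I.1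
  · simp [intervalMap, hp]
  · rw [intervalSpace, if_neg hp, Submodule.mem_bot] at hx
    simp [intervalMap, hp, hx]

theorem intervalMap_comp (I : LadderInterval n) {p q r : Ladder n} (hpq : p ≤ q) (hqr : q ≤ r) :
    intervalMap k I p r = intervalMap k I q r ∘ₗ intervalMap k I p q := by
  refine LinearMap.ext fun x => Subtype.ext ?_
  obtain ⟨x, hx⟩ := x
  by_cases hr : r ∈ I.1
  · by_cases hq : q ∈ I.1
    · simp [intervalMap, hq, hr]
    · have hp : p ∉ I.1 := fun hp => hq (I.2.1.out hp hr ⟨hpq, hqr⟩)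
      rw [intervalSpace, if_neg hp, Submodule.mem_bot] at hx
      simp [intervalMap, hq, hr, hx]
  · simp [intervalMap, hr]

/-- The interval module `V_I`. -/
def intervalModule (I : LadderInterval n) : LadderMod k n where
  obj p := FGModuleCat.of k (intervalSpace k I p)
  map {p q} _ := FGModuleCat.ofHom (intervalMap k I p q)
  map_id p := by
    rw [intervalMap_id]
    rfl
  map_comp f g := by
    rw [intervalMap_comp k I (leOfHom f) (leOfHom g)]
    rfl

/-- The generator `G`, the direct sum of all interval modules. -/
def intervalGenerator (k : Type u) [Field k] (n : ℕ) : LadderMod k n :=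
  ⨁ fun I : LadderInterval n => intervalModule k I

variable {k}

/-- Membership in `add G`: direct summands of finite direct sums of copies of `G`. -/
def IsIntervalDecomposable (X : LadderMod k n) : Prop :=
  ∃ N : ℕ, IsDirectSummand X (⨁ fun _ : Fin N => intervalGenerator k n)

/-- `f : X ⟶ M` is a right `add G`-approximation of `M`. -/
def IsRightIntervalApprox {X M : LadderMod k n} (f : X ⟶ M) : Prop :=
  IsIntervalDecomposable X ∧
    ∀ (Y : LadderMod k n), IsIntervalDecomposable Y → ∀ g : Y ⟶ M, ∃ h : Y ⟶ X, h ≫ f = g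

/-- An interval resolution
`0 ⟶ ⨁ V_J ^ d_J^{(r)} ⟶ ⋯ ⟶ ⨁ V_J ^ d_J^{(0)} ⟶ M ⟶ 0` (with `d_J^{(i)} = mult i J`),
written as a sequence whose terms of index `> r` vanish. -/
structure IntervalResolution (M : LadderMod k n) (r : ℕ) where
  /-- The multiplicities `d_J^{(i)}` (for `i ≤ r`). -/
  mult : ℕ → LadderInterval n → ℕ
  /-- The terms of the resolution. -/
  X : ℕ → LadderMod k n
  isoSum : ∀ i ≤ r, Nonempty (X i ≅
    ⨁ fun J : LadderInterval n => ⨁ fun _ : Fin (mult i J) => intervalModule k J)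
  isZero : ∀ i, r < i → IsZero (X i)
  /-- The augmentation `f_0`. -/
  aug : X 0 ⟶ M
  /-- The map `f_{i+1}`. -/
  d : ∀ i, X (i + 1) ⟶ X i
  d_aug : d 0 ≫ aug = 0
  d_d : ∀ i, d (i + 1) ≫ d i = 0
  approx_aug : IsRightIntervalApprox aug
  approx_zero : IsRightIntervalApprox (kernel.lift aug (d 0) d_aug)
  approx_succ : ∀ i, IsRightIntervalApprox (kernel.lift (d i) (d (i + 1)) (d_d i))

end IntervalModules

/-! ### Compressed multiplicities -/

/-- The indices of the vertices of `I` in row `t` (`t = 0` is the lower row). -/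
def ladderRow {n : ℕ} (I : LadderInterval n) (t : Fin 2) : Finset (Fin n) :=
  (Set.toFinite {i : Fin n | Ladder.mk i t ∈ I.1}).toFinset

theorem mem_ladderRow {n : ℕ} {I : LadderInterval n} {t : Fin 2} {i : Fin n} :
    i ∈ ladderRow I t ↔ Ladder.mk i t ∈ I.1 := by
  simp [ladderRow]

theorem ladderRow_one_nonempty {n : ℕ} {I : LadderInterval n}
    (h : ¬ (ladderRow I 0).Nonempty) : (ladderRow I 1).Nonempty := by
  obtain ⟨⟨⟨i, t⟩, hi⟩⟩ := I.2.2.nonempty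
  fin_cases t
  · exact (h ⟨i, mem_ladderRow.2 hi⟩).elim
  · exact ⟨i, mem_ladderRow.2 hi⟩

/-- The staircase shape of an interval spanning both rows. -/
theorem ladderRow_min_le {n : ℕ} {I : LadderInterval n}
    (h0 : (ladderRow I 0).Nonempty) (h1 : (ladderRow I 1).Nonempty) :
    (ladderRow I 1).min' h1 ≤ (ladderRow I 0).min' h0 := by
  obtain ⟨a, ha⟩ := h0
  obtain ⟨b, hb⟩ := h1
  rw [mem_ladderRow] at ha hb
  obtain ⟨w⟩ := I.2.2.preconnected ⟨Ladder.mk a 0, ha⟩ ⟨Ladder.mk b 1, hb⟩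
  obtain ⟨e, -, he, he'⟩ := w.exists_boundary_dart {p | p.1.2 = 0} rfl
    (fun h => one_ne_zero (α := Fin 2) h)
  obtain ⟨⟨⟨⟨i, s⟩, hi⟩, ⟨⟨j, t⟩, hj⟩⟩, hadj⟩ := e
  replace he : s = 0 := he
  replace he' : t ≠ 0 := he'
  have ht : t = 1 := by omega
  subst he ht
  have hij : i ≤ j := by
    have : Ladder.mk i 0 ⋖ Ladder.mk j 1 ∨ Ladder.mk j 1 ⋖ Ladder.mk i 0 := hadj
    rcases this with h | h
    · exact h.1.le.1
    · exact (he' (le_antisymm h.1.le.2 (Fin.zero_le _))).elim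
  refine Finset.min'_le _ _ (mem_ladderRow.2 ?_)
  have hmin := mem_ladderRow.1 ((ladderRow I 0).min'_mem ⟨a, mem_ladderRow.2 ha⟩)
  refine I.2.1.out hmin hj ⟨Ladder.mk_le_mk le_rfl (Fin.zero_le _), Ladder.mk_le_mk ?_ le_rfl⟩
  exact ((ladderRow I 0).min'_le i (mem_ladderRow.2 hi)).trans hij

/-- The vertices of the quiver `1 ← 2 → 3 ← 4 → 5`. -/
inductive ZigzagVertex : Type
  | v1 | v2 | v3 | v4 | v5

/-- The arrows of the quiver `1 ← 2 → 3 ← 4 → 5`. -/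
inductive ZigzagArrow : ZigzagVertex → ZigzagVertex → Type
  | a1 : ZigzagArrow .v2 .v1
  | a2 : ZigzagArrow .v2 .v3
  | a3 : ZigzagArrow .v4 .v3
  | a4 : ZigzagArrow .v4 .v5

instance : Quiver.{0} ZigzagVertex := ⟨ZigzagArrow⟩

/-- A morphism from the zigzag quiver to the ladder,
given by its values on the vertices. -/
def zigzagMor {n : ℕ} (p1 p2 p3 p4 p5 : Ladder n)
    (h1 : p2 ≤ p1) (h2 : p2 ≤ p3) (h3 : p4 ≤ p3) (h4 : p4 ≤ p5) : ZigzagVertex ⥤q Ladder n where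
  obj
    | .v1 => p1
    | .v2 => p2
    | .v3 => p3
    | .v4 => p4
    | .v5 => p5
  map
    | .a1 => homOfLE h1
    | .a2 => homOfLE h2
    | .a3 => homOfLE h3
    | .a4 => homOfLE h4

/-- The quiver morphism `ξ_I`. With `x_i, x_j` the ends of the lower row of `I` and `y_k, y_l`
the ends of its upper row, the vertices `1, 2, 3, 4, 5` go to
`y_l, y_k, y_i, x_i, x_j` if `I` spans both rows,
`x_j, x_i, x_i, x_i, x_j` if `I` is contained in the lower row, and
`y_l, y_k, y_k, y_k, y_l` if `I` is contained in the upper row. -/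
def xiMor {n : ℕ} (I : LadderInterval n) : ZigzagVertex ⥤q Ladder n :=
  if h0 : (ladderRow I 0).Nonempty then
    let i := (ladderRow I 0).min' h0
    let j := (ladderRow I 0).max' h0
    have hij : i ≤ j := Finset.min'_le_max' _ h0
    if h1 : (ladderRow I 1).Nonempty then
      let a := (ladderRow I 1).min' h1
      let b := (ladderRow I 1).max' h1
      have hab : a ≤ b := Finset.min'_le_max' _ h1
      zigzagMor (.mk b 1) (.mk a 1) (.mk i 1) (.mk i 0) (.mk j 0)
        (Ladder.mk_le_mk hab le_rfl) (Ladder.mk_le_mk (ladderRow_min_le h0 h1) le_rfl)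
        (Ladder.mk_le_mk le_rfl (Fin.zero_le _)) (Ladder.mk_le_mk hij le_rfl)
    else
      zigzagMor (.mk j 0) (.mk i 0) (.mk i 0) (.mk i 0) (.mk j 0)
        (Ladder.mk_le_mk hij le_rfl) le_rfl le_rfl (Ladder.mk_le_mk hij le_rfl)
  else
    have h1 := ladderRow_one_nonempty h0
    let a := (ladderRow I 1).min' h1
    let b := (ladderRow I 1).max' h1
    have hab : a ≤ b := Finset.min'_le_max' _ h1
    zigzagMor (.mk b 1) (.mk a 1) (.mk a 1) (.mk a 1) (.mk b 1)
      (Ladder.mk_le_mk hab le_rfl) le_rfl le_rfl (Ladder.mk_le_mk hab le_rfl)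

/-- The functor `F_I` from the path category of the zigzag quiver to the ladder. -/
def xiFunctor {n : ℕ} (I : LadderInterval n) : Paths ZigzagVertex ⥤ Ladder n :=
  Paths.lift (xiMor I)

section Compression

variable {k : Type u} [Field k]

/-- The compression `R_I(M) = M ∘ F_I`, a representation of the zigzag quiver. -/
def compression {n : ℕ} (I : LadderInterval n) (M : LadderMod k n) :
    Paths ZigzagVertex ⥤ FGModuleCat.{u} k :=
  xiFunctor I ⋙ M

/-- The compressed multiplicity `c^ξ_M(I)`: the multiplicity of `R_I(V_I)` in `R_I(M)`. -/
def compressedMult {n : ℕ} (M : LadderMod k n) (I : LadderInterval n) : ℕ :=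
  summandMult (compression I (intervalModule k I)) (compression I M)

/-- The interval approximation `δ^ξ_M(J) = ∑_{S ⊆ cov(J)} (-1)^{#S} c^ξ_M(⋁ S)`. -/
def intervalApproximation {n : ℕ} (M : LadderMod k n) (J : LadderInterval n) :
    ℤ :=
  ∑ S ∈ (intervalCovers J).powerset,
    (-1 : ℤ) ^ S.card * (compressedMult M (intervalJoin J S) : ℤ)

end Compression

end

/-!
The compressed multiplicity `c_M(I)` is the rank of the map from the limit to the colimit of `M`
along the zigzag `ξ_I`. The limit is `Hom(V_U, M)`, where `U` is the set of points above the values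
of `ξ_I`; this uses that the value at `3` is the join of the values at `2` and `4`. The part of the
limit that dies in the colimit is the sum of the sections over `U` that vanish at the value at `1`
and of those that vanish at the value at `5`. These two spaces and their intersection are again of
the form `Hom(V_S, M)` with `S` a convex set, so `c_M(I)` is an alternating sum of four dimensions
`dim Hom(V_S, M)` with `S` convex (`SpansInterval.summandMult_add_finrank`, `compressedMult_eq`).

A convex set is a disjoint union of unrelated intervals (`Set.OrdConnected.induction_connected`), so
an interval resolution of `M` becomes exact under `Hom(V_S, -)`, and `dim Hom(V_S, M)` is the
alternating sum of the dimensions of `Hom(V_S, X_i)`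
(`IntervalResolution.finrank_sectionSpace_eq_sum`). Hence `c_M(I)` is the alternating sum of the
`c_{X_i}(I)`. As `c_{V_K}(I)` is `1` if `I ⊆ K` and `0` otherwise (`compressedMult_intervalModule`),
`c_M(I) = ∑ K ≥ I, ∑ i, (-1)^i d_K^{(i)}`.

Möbius inversion over the covers of `J` extracts the summand with `K = J`
(`sum_powerset_intervalCovers`). The joins it needs exist because the convex hull of a union of
intervals with a common point is an interval (`exists_isLUB_of_common_point`).
-/

noncomputable section

attribute [local instance] Abelian.hasFiniteBiproducts

/-! ### Convex subsets of a finite poset and their Hasse diagrams -/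

section Convex

variable {P : Type*} [PartialOrder P] [Finite P]

theorem Set.OrdConnected.hasse_reachable_of_le {S : Set P} (hS : S.OrdConnected) {a b : S}
    (hab : a ≤ b) : ((SimpleGraph.hasse P).induce S).Reachable a b := by
  classical
  cases nonempty_fintype S
  let _ : LocallyFiniteOrder S := Fintype.toLocallyFiniteOrder
  induction le_iff_reflTransGen_covBy.1 hab with
  | refl => rfl
  | @tail c d _ hcd ih =>
    refine (ih (le_iff_reflTransGen_covBy.2 ‹_›)).trans (SimpleGraph.Adj.reachable (Or.inl ?_))
    exact (Set.OrdConnected.apply_covBy_apply_iff (OrderEmbedding.subtype (· ∈ S))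
      (by simpa using hS)).2 hcd

/-- A property of convex subsets of a finite poset holds for all of them once it holds for `∅`,
for those that are connected, and for the union of two parts without relations between them:
a convex set that is not connected splits into a connected component and the rest. -/
theorem Set.OrdConnected.induction_connected {motive : Set P → Prop} (empty : motive ∅)
    (connected : ∀ S : Set P, S.OrdConnected →
      ((SimpleGraph.hasse P).induce S).Connected → motive S)
    (union : ∀ S T : Set P, (∀ a ∈ S, ∀ b ∈ T, ¬ a ≤ b ∧ ¬ b ≤ a) →
      motive S → motive T → motive (S ∪ T))
    {S : Set P} (hS : S.OrdConnected) : motive S := by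
  induction h : S.ncard using Nat.strong_induction_on generalizing S with
  | _ m ih =>
    rcases S.eq_empty_or_nonempty with rfl | ⟨a, ha⟩
    · exact empty
    let T : Set P := {b | ∃ hb : b ∈ S, ((SimpleGraph.hasse P).induce S).Reachable ⟨a, ha⟩ ⟨b, hb⟩}
    have hTS : T ⊆ S := fun b hb => hb.1
    have hle : ∀ b ∈ S, ∀ c ∈ S, b ≤ c → (b ∈ T ↔ c ∈ T) := by
      intro b hb c hc hbc
      have hr := hS.hasse_reachable_of_le (a := ⟨b, hb⟩) (b := ⟨c, hc⟩) hbc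
      exact ⟨fun h => ⟨hc, h.2.trans hr⟩, fun h => ⟨hb, h.2.trans hr.symm⟩⟩
    have haT : a ∈ T := ⟨ha, .rfl⟩
    have hT : T.OrdConnected := ⟨fun b hb c hc x hx =>
      (hle b hb.1 x (hS.out hb.1 hc.1 hx) hx.1).1 hb⟩
    have hT' : (S \ T).OrdConnected := ⟨fun b hb c hc x hx =>
      have hxS := hS.out hb.1 hc.1 hx
      ⟨hxS, fun hxT => hb.2 ((hle b hb.1 x hxS hx.1).2 hxT)⟩⟩
    by_cases hST : S ⊆ T
    · refine connected S hS ?_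
      have : Nonempty S := ⟨⟨a, ha⟩⟩
      exact ⟨fun b c => (hST b.2).2.symm.trans (hST c.2).2⟩
    · have h1 : motive T := ih _ (h ▸ Set.ncard_lt_ncard ⟨hTS, hST⟩) hT rfl
      have h2 : motive (S \ T) := ih _ (h ▸ Set.ncard_lt_ncard
        ⟨Set.sdiff_subset, fun h' => (h' ha).2 haT⟩) hT' rfl
      rw [← Set.union_sdiff_cancel hTS]
      refine union _ _ (fun b hb c hc => ⟨fun hbc => ?_, fun hcb => ?_⟩) h1 h2
      · exact hc.2 ((hle b hb.1 c hc.1 hbc).1 hb)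
      · exact hc.2 ((hle c hc.1 b hb.1 hcb).2 hb)

end Convex

/-! ### Joins of intervals -/

section Joins

variable {n : ℕ}

/-- Intervals with a common point have a join, the convex hull of their union. -/
theorem exists_isLUB_of_common_point (F : Set (LadderInterval n)) (hF : F.Nonempty)
    (p : Ladder n) (hp : ∀ K ∈ F, p ∈ K.1) : ∃ K, IsLUB F K := by
  let T : Set (Ladder n) := ⋃ K ∈ F, K.1
  have hT : ∀ {x}, x ∈ T ↔ ∃ K ∈ F, x ∈ K.1 := by simp [T]
  let H : Set (Ladder n) := {x | ∃ a ∈ T, ∃ b ∈ T, a ≤ x ∧ x ≤ b}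
  have hTH : T ⊆ H := fun x hx => ⟨x, hx, x, hx, le_rfl, le_rfl⟩
  have hH : H.OrdConnected := ⟨by
    rintro x ⟨a, ha, -, -, hax, -⟩ y ⟨-, -, b, hb, -, hyb⟩ z hz
    exact ⟨a, ha, b, hb, hax.trans hz.1, hz.2.trans hyb⟩⟩
  have hpH : p ∈ H := by
    obtain ⟨K, hK⟩ := hF
    exact hTH (hT.2 ⟨K, hK, hp K hK⟩)
  have key : ∀ x (hx : x ∈ T),
      ((SimpleGraph.hasse (Ladder n)).induce H).Reachable ⟨p, hpH⟩ ⟨x, hTH hx⟩ := by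
    intro x hx
    obtain ⟨K, hK, hxK⟩ := hT.1 hx
    have hKH : K.1 ⊆ H := fun y hy => hTH (hT.2 ⟨K, hK, hy⟩)
    exact (K.2.2.preconnected ⟨p, hp K hK⟩ ⟨x, hxK⟩).map
      (SimpleGraph.induceHomOfLE _ hKH).toHom
  have hconn : ((SimpleGraph.hasse (Ladder n)).induce H).Connected := by
    have : Nonempty H := ⟨⟨p, hpH⟩⟩
    have : ∀ y : H, ((SimpleGraph.hasse (Ladder n)).induce H).Reachable ⟨p, hpH⟩ y := by
      rintro ⟨y, hy⟩
      obtain ⟨a, ha, -, -, hay, -⟩ := id hy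
      exact (key a ha).trans (hH.hasse_reachable_of_le (a := ⟨a, hTH ha⟩) (b := ⟨y, hy⟩) hay)
    exact ⟨fun x y => (this x).symm.trans (this y)⟩
  refine ⟨⟨H, hH, hconn⟩, fun K hK x hx => hTH (hT.2 ⟨K, hK, hx⟩), fun L hL x hx => ?_⟩
  obtain ⟨a, ha, b, hb, hax, hxb⟩ := hx
  obtain ⟨K, hK, haK⟩ := hT.1 ha
  obtain ⟨K', hK', hbK⟩ := hT.1 hb
  exact L.2.1.out (hL hK haK) (hL hK' hbK) ⟨hax, hxb⟩

theorem mem_intervalCovers {J K : LadderInterval n} : K ∈ intervalCovers J ↔ J ⋖ K := by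
  simp [intervalCovers]

theorem isLUB_intervalJoin {J : LadderInterval n} {S : Finset (LadderInterval n)}
    (hS : S ⊆ intervalCovers J) (hne : S.Nonempty) :
    IsLUB (S : Set (LadderInterval n)) (intervalJoin J S) := by
  obtain ⟨⟨p, hp⟩⟩ := J.2.2.nonempty
  have h := exists_isLUB_of_common_point (S : Set (LadderInterval n)) (by simpa using hne) p
    (fun K hK => (mem_intervalCovers.1 (hS hK)).le hp)
  rw [intervalJoin, dif_pos ⟨hne, h⟩]
  exact h.choose_spec

theorem intervalJoin_le_iff {J K : LadderInterval n} {S : Finset (LadderInterval n)}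
    (hS : S ⊆ intervalCovers J) : intervalJoin J S ≤ K ↔ J ≤ K ∧ ∀ L ∈ S, L ≤ K := by
  rcases S.eq_empty_or_nonempty with rfl | hne
  · simp [intervalJoin]
  · rw [isLUB_le_iff (isLUB_intervalJoin hS hne)]
    refine ⟨fun h => ⟨?_, fun L hL => h hL⟩, fun h L hL => h.2 L hL⟩
    obtain ⟨L, hL⟩ := hne
    exact (mem_intervalCovers.1 (hS hL)).le.trans (h hL)

open Classical in
/-- Möbius inversion in the poset of intervals: the alternating sum over sets of covers of `J`
picks out `J` among the intervals `K ≥ J`, since every `K > J` lies above a cover of `J`. -/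
theorem sum_powerset_intervalCovers (J K : LadderInterval n) :
    ∑ S ∈ (intervalCovers J).powerset,
      (-1 : ℤ) ^ S.card * (if intervalJoin J S ≤ K then 1 else 0) = if J = K then 1 else 0 := by
  by_cases hJK : J ≤ K
  · have hpow : (intervalCovers J).powerset.filter (fun S => intervalJoin J S ≤ K) =
        ((intervalCovers J).filter (· ≤ K)).powerset := by
      ext S
      simp only [Finset.mem_filter, Finset.mem_powerset]
      constructor
      · rintro ⟨h, h'⟩
        exact fun L hL => Finset.mem_filter.2 ⟨h hL, ((intervalJoin_le_iff h).1 h').2 L hL⟩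
      · intro h
        have h' : S ⊆ intervalCovers J := fun L hL => (Finset.mem_filter.1 (h hL)).1
        exact ⟨h', (intervalJoin_le_iff h').2 ⟨hJK, fun L hL => (Finset.mem_filter.1 (h hL)).2⟩⟩
    simp only [mul_ite, mul_one, mul_zero]
    rw [← Finset.sum_filter, hpow, Finset.sum_powerset_neg_one_pow_card]
    refine if_congr ?_ rfl rfl
    rw [Finset.filter_eq_empty_iff]
    constructor
    · intro h
      by_contra hne
      obtain ⟨L, hL, hLK⟩ := exists_covBy_le_of_lt (lt_of_le_of_ne hJK hne)
      exact h (mem_intervalCovers.2 hL) hLK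
    · rintro rfl L hL hLJ
      exact (mem_intervalCovers.1 hL).lt.not_ge hLJ
  · rw [if_neg fun h => hJK h.le]
    refine Finset.sum_eq_zero fun S hS => ?_
    rw [if_neg fun h => hJK ((intervalJoin_le_iff (Finset.mem_powerset.1 hS)).1 h).1, mul_zero]

end Joins

/-! ### The vertices of an interval selected by `ξ` -/

/-- An edge of the Hasse diagram inside `I` joins the two rows of `I`. -/
theorem exists_mem_both_rows {n : ℕ} {I : LadderInterval n}
    (h0 : (ladderRow I 0).Nonempty) (h1 : (ladderRow I 1).Nonempty) :
    ∃ i j : Fin n, i ≤ j ∧ Ladder.mk i 0 ∈ I.1 ∧ Ladder.mk j 1 ∈ I.1 := by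
  obtain ⟨a, ha⟩ := h0
  obtain ⟨b, hb⟩ := h1
  rw [mem_ladderRow] at ha hb
  obtain ⟨w⟩ := I.2.2.preconnected ⟨Ladder.mk a 0, ha⟩ ⟨Ladder.mk b 1, hb⟩
  obtain ⟨e, -, he, he'⟩ := w.exists_boundary_dart {p | p.1.2 = 0} rfl
    (fun h => one_ne_zero (α := Fin 2) h)
  obtain ⟨⟨⟨⟨i, s⟩, hi⟩, ⟨⟨j, t⟩, hj⟩⟩, hadj⟩ := e
  replace he : s = 0 := he
  replace he' : t ≠ 0 := he'
  have ht : t = 1 := by omega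
  subst he ht
  refine ⟨i, j, ?_, hi, hj⟩
  have : Ladder.mk i 0 ⋖ Ladder.mk j 1 ∨ Ladder.mk j 1 ⋖ Ladder.mk i 0 := hadj
  rcases this with h | h
  · exact h.1.le.1
  · exact (he' (le_antisymm h.1.le.2 (Fin.zero_le _))).elim

/-- What the argument uses of `ξ = ξ_I`: its values lie in `I`, the value at `3` is the join of the
values at `2` and `4`, and `I` is the smallest interval through the values at `1, 2, 4, 5`. -/
structure SpansInterval {n : ℕ} (ξ : ZigzagVertex ⥤q Ladder n) (I : LadderInterval n) : Prop where
  mem : ∀ x, ξ.obj x ∈ I.1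
  join_le : ∀ q, ξ.obj .v2 ≤ q → ξ.obj .v4 ≤ q → ξ.obj .v3 ≤ q
  le : ∀ K : LadderInterval n, ξ.obj .v1 ∈ K.1 → ξ.obj .v2 ∈ K.1 → ξ.obj .v4 ∈ K.1 →
    ξ.obj .v5 ∈ K.1 → I ≤ K

theorem xiMor_spansInterval {n : ℕ} (I : LadderInterval n) : SpansInterval (xiMor I) I := by
  have hmin : ∀ t (h : (ladderRow I t).Nonempty), Ladder.mk ((ladderRow I t).min' h) t ∈ I.1 :=
    fun t h => mem_ladderRow.1 (Finset.min'_mem _ h)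
  have hmax : ∀ t (h : (ladderRow I t).Nonempty), Ladder.mk ((ladderRow I t).max' h) t ∈ I.1 :=
    fun t h => mem_ladderRow.1 (Finset.max'_mem _ h)
  have hrow : ∀ (t) (h : (ladderRow I t).Nonempty) (K : LadderInterval n),
      Ladder.mk ((ladderRow I t).min' h) t ∈ K.1 → Ladder.mk ((ladderRow I t).max' h) t ∈ K.1 →
      ∀ i, Ladder.mk i t ∈ I.1 → Ladder.mk i t ∈ K.1 := by
    intro t h K ha hb i hi
    exact K.2.1.out ha hb ⟨Ladder.mk_le_mk (Finset.min'_le _ _ (mem_ladderRow.2 hi)) le_rfl,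
      Ladder.mk_le_mk (Finset.le_max' _ _ (mem_ladderRow.2 hi)) le_rfl⟩
  by_cases h0 : (ladderRow I 0).Nonempty
  · by_cases h1 : (ladderRow I 1).Nonempty
    · rw [xiMor, dif_pos h0, dif_pos h1]
      refine ⟨?_, fun q hq hq' => ⟨hq'.1, hq.2⟩, ?_⟩
      · rintro (_ | _ | _ | _ | _)
        · exact hmax 1 h1
        · exact hmin 1 h1
        · obtain ⟨i, j, hij, hi, hj⟩ := exists_mem_both_rows h0 h1
          exact I.2.1.out (hmin 0 h0) hj ⟨Ladder.mk_le_mk le_rfl (Fin.zero_le _),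
            Ladder.mk_le_mk ((Finset.min'_le _ _ (mem_ladderRow.2 hi)).trans hij) le_rfl⟩
        · exact hmin 0 h0
        · exact hmax 0 h0
      · rintro K k1 k2 k4 k5 ⟨i, t⟩ hi
        fin_cases t
        · exact hrow 0 h0 K k4 k5 i hi
        · exact hrow 1 h1 K k2 k1 i hi
    · rw [xiMor, dif_pos h0, dif_neg h1]
      refine ⟨?_, fun q hq _ => hq, ?_⟩
      · rintro (_ | _ | _ | _ | _)
        exacts [hmax 0 h0, hmin 0 h0, hmin 0 h0, hmin 0 h0, hmax 0 h0]
      · rintro K k1 k2 k4 k5 ⟨i, t⟩ hi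
        fin_cases t
        · exact hrow 0 h0 K k4 k5 i hi
        · exact (h1 ⟨i, mem_ladderRow.2 hi⟩).elim
  · have h1 := ladderRow_one_nonempty h0
    rw [xiMor, dif_neg h0]
    refine ⟨?_, fun q hq _ => hq, ?_⟩
    · rintro (_ | _ | _ | _ | _)
      exacts [hmax 1 h1, hmin 1 h1, hmin 1 h1, hmin 1 h1, hmax 1 h1]
    · rintro K k1 k2 k4 k5 ⟨i, t⟩ hi
      fin_cases t
      · exact (h0 ⟨i, mem_ladderRow.2 hi⟩).elim
      · exact hrow 1 h1 K k2 k1 i hi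

/-! ### Sections of a module over a set of points -/

section Sections

variable {k : Type u} [Field k] {n : ℕ}

/-- The structure map of a ladder module, as a linear map. -/
def structMap (M : LadderMod k n) {p q : Ladder n} (h : p ≤ q) : M.obj p →ₗ[k] M.obj q :=
  (M.map (homOfLE h)).hom.hom

theorem structMap_trans (M : LadderMod k n) {p q r : Ladder n} (h : p ≤ q) (h' : q ≤ r)
    (x : M.obj p) : structMap M h' (structMap M h x) = structMap M (h.trans h') x := by
  have := M.map_comp (homOfLE h) (homOfLE h')
  exact (LinearMap.congr_fun (congrArg (fun f => f.hom.hom) this) x).symm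

theorem structMap_refl (M : LadderMod k n) {p : Ladder n} (x : M.obj p) :
    structMap M (le_refl p) x = x :=
  LinearMap.congr_fun (congrArg (fun f => f.hom.hom) (M.map_id p)) x

theorem structMap_naturality {X Y : LadderMod k n} (f : X ⟶ Y) {p q : Ladder n} (h : p ≤ q)
    (x : X.obj p) :
    (f.app q).hom.hom (structMap X h x) = structMap Y h ((f.app p).hom.hom x) :=
  LinearMap.congr_fun (congrArg (fun g => g.hom.hom) (f.naturality (homOfLE h))) x

/-- The space of families `(v_p)` of elements of `M` that vanish off `S` and whose members at the
points of `S` are carried by the structure maps to the later members. For a convex set `S` this is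
`Hom(V_S, M)`, where `V_S` is the module with `k` at the points of `S` and `0` elsewhere. -/
def sectionSpace (S : Set (Ladder n)) (M : LadderMod k n) : Submodule k (∀ p, M.obj p) where
  carrier := {v | (∀ p ∉ S, v p = 0) ∧ ∀ p ∈ S, ∀ q, ∀ h : p ≤ q, structMap M h (v p) = v q}
  zero_mem' := ⟨fun _ _ => rfl, fun _ _ _ _ => map_zero _⟩
  add_mem' {v w} hv hw := ⟨fun p hp => by simp [hv.1 p hp, hw.1 p hp],
    fun p hp q h => by simp [hv.2 p hp q h, hw.2 p hp q h]⟩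
  smul_mem' c v hv := ⟨fun p hp => by simp [hv.1 p hp], fun p hp q h => by simp [hv.2 p hp q h]⟩

theorem mem_sectionSpace {S : Set (Ladder n)} {M : LadderMod k n} {v : ∀ p, M.obj p} :
    v ∈ sectionSpace S M ↔
      (∀ p ∉ S, v p = 0) ∧ ∀ p ∈ S, ∀ q, ∀ h : p ≤ q, structMap M h (v p) = v q := Iff.rfl

/-- Removing from `S` all that lies above points of `S` imposes vanishing at these points. -/
theorem mem_sectionSpace_diff_upperClosure {S T : Set (Ladder n)} (hT : T ⊆ S)
    {M : LadderMod k n} {v : ∀ p, M.obj p} :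
    v ∈ sectionSpace (S \ upperClosure T) M ↔ v ∈ sectionSpace S M ∧ ∀ t ∈ T, v t = 0 := by
  constructor
  · intro hv
    refine ⟨⟨fun p hp => hv.1 p fun h => hp h.1, fun p hp q h => ?_⟩,
      fun t ht => hv.1 t fun h => h.2 (subset_upperClosure ht)⟩
    by_cases hpT : p ∈ upperClosure T
    · rw [hv.1 p fun h => h.2 hpT, hv.1 q fun h' => h'.2 ((upperClosure T).upper h hpT), map_zero]
    · exact hv.2 p ⟨hp, hpT⟩ q h
  · rintro ⟨hv, hv0⟩
    refine ⟨fun p hp => ?_, fun p hp q h => hv.2 p hp.1 q h⟩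
    by_cases hpS : p ∈ S
    · obtain ⟨t, ht, htp⟩ : p ∈ upperClosure T := by
        by_contra h
        exact hp ⟨hpS, h⟩
      rw [← hv.2 t (hT ht) p htp, hv0 t ht, map_zero]
    · exact hv.1 p hpS

/-- The map on families of elements induced by a morphism. -/
def piMap {X Y : LadderMod k n} (f : X ⟶ Y) : (∀ p, X.obj p) →ₗ[k] (∀ p, Y.obj p) :=
  LinearMap.pi fun p => (f.app p).hom.hom ∘ₗ LinearMap.proj p

@[simp]
theorem piMap_apply {X Y : LadderMod k n} (f : X ⟶ Y) (v : ∀ p, X.obj p) (p : Ladder n) :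
    piMap f v p = (f.app p).hom.hom (v p) := rfl

theorem piMap_mem_sectionSpace {S : Set (Ladder n)} {X Y : LadderMod k n} (f : X ⟶ Y)
    {v : ∀ p, X.obj p} (hv : v ∈ sectionSpace S X) : piMap f v ∈ sectionSpace S Y :=
  ⟨fun p hp => by simp [hv.1 p hp],
    fun p hp q h => by rw [piMap_apply, piMap_apply, ← structMap_naturality, hv.2 p hp q h]⟩

/-- The map `Hom(V_S, X) → Hom(V_S, Y)` induced by a morphism `X ⟶ Y`. -/
def sectionMap (S : Set (Ladder n)) {X Y : LadderMod k n} (f : X ⟶ Y) :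
    sectionSpace S X →ₗ[k] sectionSpace S Y :=
  (piMap f).restrict fun _ hv => piMap_mem_sectionSpace f hv

/-- The functor `M ↦ Hom(V_S, M)`. -/
def sectionFunctor (k : Type u) [Field k] {n : ℕ} (S : Set (Ladder n)) :
    LadderMod k n ⥤ ModuleCat.{u} k where
  obj M := ModuleCat.of k (sectionSpace S M)
  map f := ModuleCat.ofHom (sectionMap S f)
  map_id _ := rfl
  map_comp _ _ := rfl

instance (S : Set (Ladder n)) : (sectionFunctor k S).Additive where
  map_add := rfl

theorem finrank_sectionSpace_of_iso (S : Set (Ladder n)) {X Y : LadderMod k n} (e : X ≅ Y) :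
    Module.finrank k (sectionSpace S X) = Module.finrank k (sectionSpace S Y) :=
  ((sectionFunctor k S).mapIso e).toLinearEquiv.finrank_eq

theorem finrank_sectionSpace_of_isZero (S : Set (Ladder n)) {X : LadderMod k n} (h : IsZero X) :
    Module.finrank k (sectionSpace S X) = 0 := by
  have := ModuleCat.subsingleton_of_isZero ((sectionFunctor k S).map_isZero h)
  exact Module.finrank_zero_of_subsingleton (M := (sectionFunctor k S).obj X)

theorem finrank_sectionSpace_biproduct (S : Set (Ladder n)) {ι : Type} [Fintype ι]
    (X : ι → LadderMod k n) :
    Module.finrank k (sectionSpace S (⨁ X)) = ∑ i, Module.finrank k (sectionSpace S (X i)) := by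
  have e := (sectionFunctor k S).mapBiproduct X ≪≫ ModuleCat.biproductIsoPi _
  refine e.toLinearEquiv.finrank_eq.trans ?_
  exact Module.finrank_pi_fintype k (M := fun i => sectionSpace S (X i))

end Sections

/-! ### Interval resolutions are exact on sections over convex sets -/

section Resolution

variable {k : Type u} [Field k] {n : ℕ}

theorem intervalMap_apply_of_mem {I : LadderInterval n} (p : Ladder n) {q : Ladder n}
    (hq : q ∈ I.1) (c : intervalSpace k I p) : (intervalMap k I p q c : k) = c := by
  simp [intervalMap, hq]

theorem intervalSpace_eq_zero {I : LadderInterval n} {p : Ladder n} (hp : p ∉ I.1)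
    (c : intervalSpace k I p) : c = 0 := by
  obtain ⟨c, hc⟩ := c
  rw [intervalSpace, if_neg hp, Submodule.mem_bot] at hc
  exact Subtype.ext hc

open Classical in
/-- The generator `1` of `V_I` at the points of `I`, and `0` elsewhere. -/
def intervalGen (k : Type u) [Field k] (I : LadderInterval n) (p : Ladder n) :
    intervalSpace k I p :=
  ⟨if p ∈ I.1 then 1 else 0, by
    by_cases hp : p ∈ I.1
    · rw [intervalSpace, if_pos hp]
      exact Submodule.mem_top
    · rw [if_neg hp]
      exact Submodule.zero_mem _⟩

theorem intervalGen_coe_of_mem {I : LadderInterval n} {p : Ladder n} (hp : p ∈ I.1) :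
    (intervalGen k I p : k) = 1 := if_pos hp

theorem smul_intervalGen {I : LadderInterval n} (p : Ladder n) (c : intervalSpace k I p) :
    (c : k) • intervalGen k I p = c := by
  by_cases hp : p ∈ I.1
  · exact Subtype.ext (by simp [intervalGen_coe_of_mem hp])
  · rw [intervalSpace_eq_zero hp c]
    exact zero_smul _ _

/-- The generators of `V_I`, as a family of elements of the module. -/
def intervalSection (k : Type u) [Field k] (I : LadderInterval n) (p : Ladder n) :
    (intervalModule k I).obj p := intervalGen k I p

theorem intervalSection_mem (I : LadderInterval n) :
    intervalSection k I ∈ sectionSpace I.1 (intervalModule k I) := by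
  refine ⟨fun p hp => intervalSpace_eq_zero hp _, fun p hp q h => ?_⟩
  change intervalMap k I p q (intervalGen k I p) = intervalGen k I q
  by_cases hq : q ∈ I.1
  · exact Subtype.ext (by
      rw [intervalMap_apply_of_mem p hq, intervalGen_coe_of_mem hp, intervalGen_coe_of_mem hq])
  · rw [intervalSpace_eq_zero hq (intervalGen k I q)]
    exact intervalSpace_eq_zero hq _

/-- The morphism `V_I ⟶ M` that a section over `I` defines. -/
def homOfSection (I : LadderInterval n) {M : LadderMod k n} {v : ∀ p, M.obj p}
    (hv : v ∈ sectionSpace I.1 M) : intervalModule k I ⟶ M where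
  app p := ConcreteCategory.ofHom
    ((LinearMap.toSpanSingleton k (M.obj p) (v p)) ∘ₗ (intervalSpace k I p).subtype)
  naturality p q f := by
    refine FGModuleCat.hom_ext (LinearMap.ext fun c => ?_)
    obtain ⟨c, rfl⟩ : ∃ c' : intervalSpace k I p, c' = c := ⟨c, rfl⟩
    change (intervalMap k I p q c : k) • v q = structMap M (leOfHom f) ((c : k) • v p)
    by_cases hp : p ∈ I.1
    · rw [map_smul, hv.2 p hp q (leOfHom f)]
      by_cases hq : q ∈ I.1
      · rw [intervalMap_apply_of_mem p hq]
      · rw [hv.1 q hq, smul_zero, smul_zero]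
    · rw [hv.1 p hp, smul_zero, map_zero, intervalSpace_eq_zero hp c, map_zero]
      exact zero_smul _ _

theorem piMap_homOfSection (I : LadderInterval n) {M : LadderMod k n} {v : ∀ p, M.obj p}
    (hv : v ∈ sectionSpace I.1 M) : piMap (homOfSection I hv) (intervalSection k I) = v := by
  funext p
  change (intervalGen k I p : k) • v p = v p
  by_cases hp : p ∈ I.1
  · rw [intervalGen_coe_of_mem hp, one_smul]
  · rw [hv.1 p hp, smul_zero]

/-- A morphism out of `V_I` is determined by the images of the generators. -/
theorem intervalModule_hom_ext {I : LadderInterval n} {M : LadderMod k n}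
    {f g : intervalModule k I ⟶ M}
    (h : piMap f (intervalSection k I) = piMap g (intervalSection k I)) : f = g := by
  refine NatTrans.ext (funext fun p => FGModuleCat.hom_ext
    (LinearMap.ext fun (c : intervalSpace k I p) => ?_))
  have key : ∀ f : intervalModule k I ⟶ M,
      (f.app p).hom.hom c = (c : k) • piMap f (intervalSection k I) p := fun f =>
    (congrArg (f.app p).hom.hom (smul_intervalGen p c).symm).trans
      (LinearMap.map_smul (f.app p).hom.hom (c : k) (intervalSection k I p))
  exact (key f).trans ((congrArg (fun v => (c : k) • v p) h).trans (key g).symm)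

/-- If the morphisms from interval modules that `g` kills lift along `f`, then so do
the sections over any convex set: a convex set is a disjoint union of unrelated intervals. -/
theorem exists_section_lift {X Y Z : LadderMod k n} (f : X ⟶ Y) (g : Y ⟶ Z)
    (hfg : ∀ (I : LadderInterval n) (φ : intervalModule k I ⟶ Y), φ ≫ g = 0 →
      ∃ ψ : intervalModule k I ⟶ X, ψ ≫ f = φ)
    {S : Set (Ladder n)} (hS : S.OrdConnected) {v : ∀ p, Y.obj p} (hv : v ∈ sectionSpace S Y)
    (hgv : piMap g v = 0) : ∃ w ∈ sectionSpace S X, piMap f w = v := by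
  classical
  revert v
  refine hS.induction_connected (motive := fun S => ∀ {v : ∀ p, Y.obj p},
    v ∈ sectionSpace S Y → piMap g v = 0 → ∃ w ∈ sectionSpace S X, piMap f w = v) ?_ ?_ ?_
  · intro v hv _
    refine ⟨0, zero_mem _, ?_⟩
    rw [map_zero]
    exact funext fun p => (hv.1 p (Set.notMem_empty p)).symm
  · intro S hS hS' v hv hgv
    obtain ⟨ψ, hψ⟩ := hfg ⟨S, hS, hS'⟩ (homOfSection ⟨S, hS, hS'⟩ hv) (by
      refine intervalModule_hom_ext ?_
      have : piMap (homOfSection ⟨S, hS, hS'⟩ hv ≫ g) (intervalSection k _) =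
        piMap g (piMap (homOfSection ⟨S, hS, hS'⟩ hv) (intervalSection k _)) := rfl
      rw [this, piMap_homOfSection, hgv]
      rfl)
    refine ⟨piMap ψ (intervalSection k _),
      piMap_mem_sectionSpace ψ (intervalSection_mem ⟨S, hS, hS'⟩), ?_⟩
    rw [← piMap_homOfSection ⟨S, hS, hS'⟩ hv, ← hψ]
    rfl
  · intro S T hST ihS ihT v hv hgv
    -- The restrictions of `v` to `S` and to `T` are sections, and are lifted separately.
    have hrestr : ∀ A B : Set (Ladder n), (∀ a ∈ A, ∀ b ∈ B, ¬ a ≤ b) → v ∈ sectionSpace (A ∪ B) Y →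
        (fun p => if p ∈ A then v p else 0) ∈ sectionSpace A Y := by
      intro A B hAB hv
      refine ⟨fun p hp => if_neg hp, fun p hp q h => ?_⟩
      dsimp only
      rw [if_pos hp, hv.2 p (Or.inl hp) q h]
      by_cases hq : q ∈ A
      · rw [if_pos hq]
      · rw [if_neg hq]
        exact hv.1 q (not_or.2 ⟨hq, fun hqB => hAB p hp q hqB h⟩)
    have hkill : ∀ A : Set (Ladder n), piMap g (fun p => if p ∈ A then v p else 0) = 0 := by
      intro A
      funext p
      rw [piMap_apply]
      split_ifs
      · exact congrFun hgv p
      · exact map_zero _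
    have hle : ∀ A B : Set (Ladder n), (∀ b ∈ B, ∀ a ∈ A, ¬ b ≤ a) →
        sectionSpace A X ≤ sectionSpace (A ∪ B) X := by
      intro A B hAB w hw
      refine ⟨fun p hp => hw.1 p fun h => hp (Or.inl h), fun p hp q h => ?_⟩
      by_cases hpA : p ∈ A
      · exact hw.2 p hpA q h
      · rw [hw.1 p hpA, map_zero, hw.1 q fun hq => hAB p (hp.resolve_left hpA) q hq h]
    obtain ⟨w, hw, hwv⟩ := ihS (hrestr S T (fun a ha b hb => (hST a ha b hb).1) hv) (hkill S)
    obtain ⟨w', hw', hwv'⟩ := ihT (hrestr T S (fun b hb a ha => (hST a ha b hb).2)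
      (Set.union_comm S T ▸ hv)) (hkill T)
    refine ⟨w + w', add_mem (hle S T (fun b hb a ha => (hST a ha b hb).2) hw) ?_, ?_⟩
    · rw [Set.union_comm]
      exact hle T S (fun a ha b hb => (hST a ha b hb).1) hw'
    · rw [map_add, hwv, hwv']
      funext p
      by_cases hpS : p ∈ S
      · have hpT : p ∉ T := fun h => (hST p hpS p h).1 le_rfl
        simp [hpS, hpT]
      · by_cases hpT : p ∈ T
        · simp [hpS, hpT]
        · simp [hpS, hpT, hv.1 p (not_or.2 ⟨hpS, hpT⟩)]

/-- The splitting lemma: a retract is a direct summand. -/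
theorem isDirectSummand_of_retract {C : Type*} [Category* C] [Abelian C] {X Y : C}
    (s : Y ⟶ X) (p : X ⟶ Y) (h : s ≫ p = 𝟙 Y) : IsDirectSummand Y X := by
  have : IsSplitMono s := ⟨⟨⟨p, h⟩⟩⟩
  have hb := isBilimitBinaryBiconeOfIsSplitMonoOfCokernel (cokernelIsCokernel s)
  exact ⟨_, ⟨biprod.uniqueUpToIso _ _ hb⟩⟩

theorem isIntervalDecomposable_intervalModule (I : LadderInterval n) :
    IsIntervalDecomposable (intervalModule k I) := by
  classical
  let s : intervalModule k I ⟶ intervalGenerator k n := biproduct.ι (intervalModule k) I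
  let p : intervalGenerator k n ⟶ intervalModule k I := biproduct.π (intervalModule k) I
  have hsp : s ≫ p = 𝟙 _ := biproduct.ι_π_self _ _
  refine ⟨1, isDirectSummand_of_retract
    (s ≫ biproduct.ι (fun _ : Fin 1 => intervalGenerator k n) 0)
    (biproduct.π (fun _ : Fin 1 => intervalGenerator k n) 0 ≫ p) ?_⟩
  rw [Category.assoc, biproduct.ι_π_self_assoc, hsp]

namespace IntervalResolution

variable {M : LadderMod k n} {r : ℕ}

/-- The kernel of the map out of the `i`-th term, on sections over `S`. -/
def sectionKer (R : IntervalResolution M r) (S : Set (Ladder n)) :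
    (i : ℕ) → Submodule k (sectionSpace S (R.X i))
  | 0 => LinearMap.ker (sectionMap S R.aug)
  | i + 1 => LinearMap.ker (sectionMap S (R.d i))

/-- An approximation `X ⟶ Ker g` makes `X ⟶ Y ⟶ Z` exact at `Y` on the morphisms from interval
modules. -/
theorem lift_of_kernel_approx {X Y Z : LadderMod k n} {f : X ⟶ Y} {g : Y ⟶ Z} (w : f ≫ g = 0)
    (h : IsRightIntervalApprox (kernel.lift g f w)) (I : LadderInterval n)
    (φ : intervalModule k I ⟶ Y) (hφ : φ ≫ g = 0) : ∃ ψ : intervalModule k I ⟶ X, ψ ≫ f = φ := by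
  obtain ⟨ψ, hψ⟩ := h.2 _ (isIntervalDecomposable_intervalModule I) (kernel.lift g φ hφ)
  refine ⟨ψ, ?_⟩
  rw [← kernel.lift_ι g f w, ← Category.assoc, hψ, kernel.lift_ι]

theorem finrank_eq_of_exact {X Y Z : LadderMod k n} {f : X ⟶ Y} {g : Y ⟶ Z} (w : f ≫ g = 0)
    (h : IsRightIntervalApprox (kernel.lift g f w)) {S : Set (Ladder n)} (hS : S.OrdConnected) :
    Module.finrank k (sectionSpace S X) = Module.finrank k (LinearMap.ker (sectionMap S g)) +
      Module.finrank k (LinearMap.ker (sectionMap S f)) := by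
  have hrange : LinearMap.range (sectionMap S f) = LinearMap.ker (sectionMap S g) := by
    apply le_antisymm
    · rintro _ ⟨v, rfl⟩
      rw [LinearMap.mem_ker]
      have : sectionMap S g (sectionMap S f v) = sectionMap S (f ≫ g) v := rfl
      rw [this, w]
      rfl
    · rintro ⟨v, hv⟩ hgv
      obtain ⟨w, hw, hwv⟩ := exists_section_lift f g (lift_of_kernel_approx w h) hS hv
        (congrArg Subtype.val hgv)
      exact ⟨⟨w, hw⟩, Subtype.ext hwv⟩
  rw [← hrange, LinearMap.finrank_range_add_finrank_ker]

theorem finrank_succ (R : IntervalResolution M r) {S : Set (Ladder n)} (hS : S.OrdConnected)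
    (m : ℕ) : Module.finrank k (sectionSpace S (R.X (m + 1))) =
      Module.finrank k (R.sectionKer S m) + Module.finrank k (R.sectionKer S (m + 1)) := by
  cases m with
  | zero => exact finrank_eq_of_exact R.d_aug R.approx_zero hS
  | succ m => exact finrank_eq_of_exact (R.d_d m) (R.approx_succ m) hS

/-- The Euler characteristic of the first terms of an interval resolution, with the kernel at the
last of them as the error term. -/
theorem finrank_eq_sum_add (R : IntervalResolution M r) {S : Set (Ladder n)} (hS : S.OrdConnected)
    (m : ℕ) : (Module.finrank k (sectionSpace S M) : ℤ) =
      ∑ i ∈ Finset.range (m + 1), (-1 : ℤ) ^ i * (Module.finrank k (sectionSpace S (R.X i)) : ℤ) +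
        (-1) ^ (m + 1) * (Module.finrank k (R.sectionKer S m) : ℤ) := by
  induction m with
  | zero =>
    have hsurj : Function.Surjective (sectionMap S R.aug) := by
      rintro ⟨v, hv⟩
      obtain ⟨w, hw, hwv⟩ := exists_section_lift R.aug (0 : M ⟶ M)
        (fun I φ _ => R.approx_aug.2 _ (isIntervalDecomposable_intervalModule I) φ) hS hv rfl
      exact ⟨⟨w, hw⟩, Subtype.ext hwv⟩
    have h := LinearMap.finrank_range_add_finrank_ker (sectionMap S R.aug)
    rw [LinearMap.range_eq_top.2 hsurj, finrank_top] at h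
    replace h : _ + Module.finrank k (R.sectionKer S 0) = _ := h
    rw [Finset.sum_range_one, ← h]
    push_cast
    ring
  | succ m ih =>
    rw [Finset.sum_range_succ, ih, R.finrank_succ hS m]
    push_cast
    ring

/-- The Euler characteristic of an interval resolution, on sections over a convex set. -/
theorem finrank_sectionSpace_eq_sum [Fintype (LadderInterval n)]
    (R : IntervalResolution M r) {S : Set (Ladder n)} (hS : S.OrdConnected) :
    (Module.finrank k (sectionSpace S M) : ℤ) =
      ∑ i ∈ Finset.range (r + 1), (-1 : ℤ) ^ i *
        ∑ K, (R.mult i K : ℤ) * (Module.finrank k (sectionSpace S (intervalModule k K)) : ℤ) := by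
  rw [R.finrank_eq_sum_add hS r]
  have hker : Module.finrank k (R.sectionKer S r) = 0 := by
    have h := R.finrank_succ hS r
    rw [finrank_sectionSpace_of_isZero S (R.isZero _ r.lt_succ_self)] at h
    omega
  rw [hker, Nat.cast_zero, mul_zero, add_zero]
  refine Finset.sum_congr rfl fun i hi => ?_
  obtain ⟨e⟩ := R.isoSum i (Nat.lt_succ_iff.1 (Finset.mem_range.1 hi))
  rw [finrank_sectionSpace_of_iso S e, finrank_sectionSpace_biproduct]
  push_cast
  refine congrArg _ (Finset.sum_congr rfl fun K _ => ?_)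
  rw [finrank_sectionSpace_biproduct, Finset.sum_const, Finset.card_univ, Fintype.card_fin,
    smul_eq_mul, Nat.cast_mul]

end IntervalResolution

end Resolution

/-! ### Sections along a zigzag -/

namespace SpansInterval

variable {k : Type u} [Field k] {n : ℕ} {ξ : ZigzagVertex ⥤q Ladder n} {I : LadderInterval n}

/-- The set of points above some value of `ξ`. -/
def upset (ξ : ZigzagVertex ⥤q Ladder n) : Set (Ladder n) := {q | ξ.obj .v2 ≤ q ∨ ξ.obj .v4 ≤ q}

theorem isUpperSet_upset (ξ : ZigzagVertex ⥤q Ladder n) : IsUpperSet (upset ξ) :=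
  fun _ _ hab ha => ha.imp hab.trans' hab.trans'

theorem le21 (ξ : ZigzagVertex ⥤q Ladder n) : ξ.obj .v2 ≤ ξ.obj .v1 :=
  leOfHom (ξ.map (ZigzagArrow.a1 : ZigzagVertex.v2 ⟶ .v1))

theorem le23 (ξ : ZigzagVertex ⥤q Ladder n) : ξ.obj .v2 ≤ ξ.obj .v3 :=
  leOfHom (ξ.map (ZigzagArrow.a2 : ZigzagVertex.v2 ⟶ .v3))

theorem le43 (ξ : ZigzagVertex ⥤q Ladder n) : ξ.obj .v4 ≤ ξ.obj .v3 :=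
  leOfHom (ξ.map (ZigzagArrow.a3 : ZigzagVertex.v4 ⟶ .v3))

theorem le45 (ξ : ZigzagVertex ⥤q Ladder n) : ξ.obj .v4 ≤ ξ.obj .v5 :=
  leOfHom (ξ.map (ZigzagArrow.a4 : ZigzagVertex.v4 ⟶ .v5))

theorem obj_mem_upset (ξ : ZigzagVertex ⥤q Ladder n) : ∀ x, ξ.obj x ∈ upset ξ
  | .v1 => Or.inl (le21 ξ)
  | .v2 => Or.inl le_rfl
  | .v3 => Or.inl (le23 ξ)
  | .v4 => Or.inr le_rfl
  | .v5 => Or.inr (le45 ξ)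

/-- Values at the sources `2` and `4` of the zigzag that have the same image at `3` extend to
a section over the points above `ξ`: this is where the value at `3` has to be a join. -/
theorem exists_section (hξ : SpansInterval ξ I) {M : LadderMod k n}
    (a : M.obj (ξ.obj .v2)) (b : M.obj (ξ.obj .v4))
    (hab : structMap M (le23 ξ) a = structMap M (le43 ξ) b) :
    ∃ v ∈ sectionSpace (upset ξ) M, v (ξ.obj .v2) = a ∧ v (ξ.obj .v4) = b := by
  classical
  let v : ∀ q, M.obj q := fun q =>
    if h : ξ.obj .v2 ≤ q then structMap M h a else if h : ξ.obj .v4 ≤ q then structMap M h b else 0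
  have hv2 : ∀ q (h : ξ.obj .v2 ≤ q), v q = structMap M h a := fun q h => dif_pos h
  have hv4 : ∀ q (h : ξ.obj .v4 ≤ q), v q = structMap M h b := by
    intro q h
    by_cases h' : ξ.obj .v2 ≤ q
    · have h3 := hξ.join_le q h' h
      rw [hv2 q h', ← structMap_trans M (le23 ξ) h3, hab, structMap_trans]
    · exact (dif_neg h').trans (dif_pos h)
  refine ⟨v, ⟨fun p hp => ?_, ?_⟩, ?_, ?_⟩
  · exact (dif_neg fun h => hp (Or.inl h)).trans (dif_neg fun h => hp (Or.inr h))
  · rintro p (hp | hp) q h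
    · rw [hv2 p hp, hv2 q (hp.trans h), structMap_trans]
    · rw [hv4 p hp, hv4 q (hp.trans h), structMap_trans]
  · rw [hv2 _ le_rfl, structMap_refl]
  · rw [hv4 _ le_rfl, structMap_refl]

theorem ordConnected_diff (ξ : ZigzagVertex ⥤q Ladder n) (T : Set (Ladder n)) :
    (upset ξ \ upperClosure T).OrdConnected :=
  (isUpperSet_upset ξ).ordConnected.inter (upperClosure T).upper.compl.ordConnected

theorem image_subset_upset (ξ : ZigzagVertex ⥤q Ladder n) (T : Set ZigzagVertex) :
    ξ.obj '' T ⊆ upset ξ := by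
  rintro _ ⟨x, -, rfl⟩
  exact obj_mem_upset ξ x

/-- The sections over the points above `ξ` that vanish at the values of `ξ` on `T`. -/
abbrev vanishing (ξ : ZigzagVertex ⥤q Ladder n) (T : Set ZigzagVertex) (M : LadderMod k n) :
    Submodule k (∀ p, M.obj p) :=
  sectionSpace (upset ξ \ upperClosure (ξ.obj '' T)) M

theorem mem_vanishing {T : Set ZigzagVertex} {M : LadderMod k n} {v : ∀ p, M.obj p} :
    v ∈ vanishing ξ T M ↔ v ∈ sectionSpace (upset ξ) M ∧ ∀ x ∈ T, v (ξ.obj x) = 0 := by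
  rw [vanishing, mem_sectionSpace_diff_upperClosure (image_subset_upset ξ T), Set.forall_mem_image]

/-- The sections that are sums of one vanishing at the value at `1` and one vanishing at the
value at `5`: these are the sections that die in the colimit over the zigzag. -/
abbrev dying (ξ : ZigzagVertex ⥤q Ladder n) (M : LadderMod k n) : Submodule k (∀ p, M.obj p) :=
  vanishing ξ {.v1} M ⊔ vanishing ξ {.v5} M

theorem dying_le (M : LadderMod k n) : dying ξ M ≤ sectionSpace (upset ξ) M :=
  sup_le (fun _ h => (mem_vanishing.1 h).1) (fun _ h => (mem_vanishing.1 h).1)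

theorem finrank_dying_add (M : LadderMod k n) :
    Module.finrank k (dying ξ M) + Module.finrank k (vanishing ξ {.v1, .v5} M) =
      Module.finrank k (vanishing ξ {.v1} M) + Module.finrank k (vanishing ξ {.v5} M) := by
  have h : vanishing ξ {.v1} M ⊓ vanishing ξ {.v5} M = vanishing ξ {.v1, .v5} M := by
    ext v
    simp only [Submodule.mem_inf, mem_vanishing, Set.mem_singleton_iff, forall_eq,
      Set.mem_insert_iff, forall_eq_or_imp]
    tauto
  rw [← h, Submodule.finrank_sup_add_finrank_inf_eq]

/-- A functional on the sections that is zero on those dying in the colimit comes from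
a functional on the colimit of the zigzag, that is, from a compatible family of functionals. -/
theorem exists_functionals (hξ : SpansInterval ξ I) (M : LadderMod k n)
    (g : sectionSpace (upset ξ) M →ₗ[k] k) (hg : ∀ v, v.1 ∈ dying ξ M → g v = 0) :
    ∃ φ : ∀ x, M.obj (ξ.obj x) →ₗ[k] k,
      (∀ x y (e : x ⟶ y) (m : M.obj (ξ.obj x)), φ y (structMap M (leOfHom (ξ.map e)) m) = φ x m) ∧
      ∀ (v : sectionSpace (upset ξ) M) (x : ZigzagVertex), φ x (v.1 (ξ.obj x)) = g v := by
  let W := sectionSpace (upset ξ) M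
  let α1 := structMap M (le21 ξ)
  let α2 := structMap M (le23 ξ)
  let α3 := structMap M (le43 ξ)
  let α4 := structMap M (le45 ξ)
  -- The colimit of the zigzag is the quotient of `M₁ × M₃ × M₅` by the image of `M₂ × M₄`. A
  -- functional on it with the prescribed values at the sections exists as soon as `g` vanishes
  -- at every section `v` for which `(v, a, b) ∈ ker Ψ` for some `a` and `b`.
  let Ψ : (W × M.obj (ξ.obj .v2) × M.obj (ξ.obj .v4)) →ₗ[k]
      (M.obj (ξ.obj .v1) × M.obj (ξ.obj .v3) × M.obj (ξ.obj .v5)) :=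
    LinearMap.coprod
      (LinearMap.prod (LinearMap.proj (ξ.obj .v1) ∘ₗ W.subtype) 0)
      (LinearMap.coprod (LinearMap.prod α1 (LinearMap.prod (-α2) 0))
        (LinearMap.prod 0 (LinearMap.prod α3 (-α4))))
  have hΨ : ∀ v a b, Ψ (v, a, b) = (v.1 (ξ.obj .v1) + α1 a, -α2 a + α3 b, -α4 b) := by
    intro v a b
    simp [Ψ]
  have hker : g ∘ₗ LinearMap.fst k W _ ∈ (LinearMap.ker Ψ).dualAnnihilator := by
    rw [Submodule.mem_dualAnnihilator]
    rintro ⟨v, a, b⟩ h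
    rw [LinearMap.mem_ker, hΨ, Prod.mk_eq_zero, Prod.mk_eq_zero] at h
    obtain ⟨h1, h3, h5⟩ := h
    obtain ⟨w, hw, rfl, rfl⟩ := hξ.exists_section a b (neg_add_eq_zero.1 h3)
    -- `(a, b)` extends to a section `w` that vanishes at `5`, and `v + w` vanishes at `1`.
    have hw1 : α1 (w (ξ.obj .v2)) = w (ξ.obj .v1) := hw.2 _ (obj_mem_upset ξ _) _ _
    have hw5 : α4 (w (ξ.obj .v4)) = w (ξ.obj .v5) := hw.2 _ (obj_mem_upset ξ _) _ _
    have e1 : g (v + ⟨w, hw⟩) = 0 := hg _ (Submodule.mem_sup_left (mem_vanishing.2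
      ⟨(v + ⟨w, hw⟩ : W).2, by
        simp only [Set.mem_singleton_iff, forall_eq]
        exact (congrArg (v.1 (ξ.obj .v1) + ·) hw1.symm).trans h1⟩))
    have e5 : g ⟨w, hw⟩ = 0 := hg _ (Submodule.mem_sup_right (mem_vanishing.2
      ⟨hw, by
        simp only [Set.mem_singleton_iff, forall_eq]
        rw [← hw5]
        exact neg_eq_zero.1 h5⟩))
    rw [map_add, e5, add_zero] at e1
    exact e1
  rw [← LinearMap.range_dualMap_eq_dualAnnihilator_ker] at hker
  obtain ⟨φ, hφ⟩ := hker
  have hφ' : ∀ v a b, φ (v.1 (ξ.obj .v1) + α1 a, -α2 a + α3 b, -α4 b) = g v := by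
    intro v a b
    rw [← hΨ]
    exact LinearMap.congr_fun hφ (v, a, b)
  let φ1 := φ ∘ₗ LinearMap.inl k _ _
  let φ3 := φ ∘ₗ LinearMap.inr k _ _ ∘ₗ LinearMap.inl k _ _
  let φ5 := φ ∘ₗ LinearMap.inr k _ _ ∘ₗ LinearMap.inr k _ _
  have hsplit : ∀ a b c, φ (a, b, c) = φ1 a + φ3 b + φ5 c := by
    intro a b c
    simp only [φ1, φ3, φ5, LinearMap.comp_apply, ← map_add]
    simp
  have h12 : ∀ a, φ1 (α1 a) = φ3 (α2 a) := by
    intro a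
    have := hφ' 0 a 0
    rw [hsplit] at this
    simpa [add_neg_eq_zero] using this
  have h45 : ∀ b, φ3 (α3 b) = φ5 (α4 b) := by
    intro a
    have := hφ' 0 0 a
    rw [hsplit] at this
    simpa [add_neg_eq_zero] using this
  have h1 : ∀ v : W, φ1 (v.1 (ξ.obj .v1)) = g v := by
    intro v
    have := hφ' v 0 0
    rw [hsplit] at this
    simpa using this
  let φ' : ∀ x, M.obj (ξ.obj x) →ₗ[k] k
    | .v1 => φ1
    | .v2 => φ1 ∘ₗ α1
    | .v3 => φ3
    | .v4 => φ5 ∘ₗ α4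
    | .v5 => φ5
  have hcompat : ∀ x y (e : x ⟶ y) (m : M.obj (ξ.obj x)),
      φ' y (structMap M (leOfHom (ξ.map e)) m) = φ' x m := by
    intro x y e
    match x, y, e with
    | _, _, .a1 => exact fun m => rfl
    | _, _, .a2 => exact fun m => (h12 m).symm
    | _, _, .a3 => exact fun m => h45 m
    | _, _, .a4 => exact fun m => rfl
  have hstep : ∀ x y (e : x ⟶ y) (v : W),
      φ' y (v.1 (ξ.obj y)) = φ' x (v.1 (ξ.obj x)) := by
    intro x y e v
    rw [← hcompat x y e, v.2.2 _ (obj_mem_upset ξ _)]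
  refine ⟨φ', hcompat, fun v => ?_⟩
  have k1 : φ' .v1 (v.1 (ξ.obj .v1)) = g v := h1 v
  have k2 := (hstep _ _ ZigzagArrow.a1 v).symm.trans k1
  have k3 := (hstep _ _ ZigzagArrow.a2 v).trans k2
  have k4 := (hstep _ _ ZigzagArrow.a3 v).symm.trans k3
  have k5 := (hstep _ _ ZigzagArrow.a4 v).trans k4
  rintro (_ | _ | _ | _ | _)
  exacts [k1, k2, k3, k4, k5]

end SpansInterval

/-! ### The compressed multiplicity as a dimension -/

section Coordinates

variable {k : Type u} [Field k] {n : ℕ}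

/-- The inclusion of the space of `V_I` at `p` into `k`. -/
def intervalCoord (I : LadderInterval n) (p : Ladder n) :
    (intervalModule k I).obj p →ₗ[k] k := (intervalSpace k I p).subtype

theorem intervalCoord_injective (I : LadderInterval n) (p : Ladder n) :
    Function.Injective (intervalCoord (k := k) I p) := Subtype.val_injective

theorem intervalCoord_structMap {I : LadderInterval n} {p q : Ladder n} (h : p ≤ q) (hq : q ∈ I.1)
    (c : (intervalModule k I).obj p) :
    intervalCoord I q (structMap _ h c) = intervalCoord I p c :=
  intervalMap_apply_of_mem p hq c

theorem intervalCoord_intervalSection {I : LadderInterval n} {p : Ladder n} (hp : p ∈ I.1) :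
    intervalCoord I p (intervalSection k I p) = 1 := intervalGen_coe_of_mem hp

theorem eq_zero_of_notMem {I : LadderInterval n} {p : Ladder n} (hp : p ∉ I.1)
    (c : (intervalModule k I).obj p) : c = 0 := intervalSpace_eq_zero hp c

end Coordinates

/-- Splitting off `d` copies of `L` amounts to `d` inclusions and `d` projections that are
biorthogonal. -/
theorem isDirectSummand_biproduct_iff {C : Type u} [Category* C] [Abelian C] {L X : C} {d : ℕ} :
    IsDirectSummand (⨁ fun _ : Fin d => L) X ↔ ∃ (s : Fin d → (L ⟶ X)) (p : Fin d → (X ⟶ L)),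
      ∀ i j, s i ≫ p j = if i = j then 𝟙 L else 0 := by
  constructor
  · rintro ⟨Z, ⟨e⟩⟩
    refine ⟨fun i => biproduct.ι (fun _ : Fin d => L) i ≫ biprod.inl ≫ e.inv,
      fun j => e.hom ≫ biprod.fst ≫ biproduct.π (fun _ : Fin d => L) j, fun i j => ?_⟩
    simp only [Category.assoc, Iso.inv_hom_id_assoc, biprod.inl_fst_assoc, biproduct.ι_π]
    split_ifs <;> rfl
  · rintro ⟨s, p, hsp⟩
    refine isDirectSummand_of_retract (biproduct.desc s) (biproduct.lift p) ?_
    refine biproduct.hom_ext' _ _ fun i => biproduct.hom_ext _ _ fun j => ?_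
    rw [Category.comp_id, biproduct.ι_desc_assoc, Category.assoc, biproduct.lift_π, hsp,
      biproduct.ι_π]
    split_ifs <;> rfl

/-- If `Φ : W → F` is onto and `D ≤ W` lies in its kernel, then `dim F + dim D ≤ dim W`. -/
theorem finrank_add_le_of_surjective {k V F : Type*} [Field k] [AddCommGroup V] [Module k V]
    [FiniteDimensional k V] [AddCommGroup F] [Module k F] {D W : Submodule k V} (hDW : D ≤ W)
    (Φ : W →ₗ[k] F) (hΦ : Function.Surjective Φ) (hD : ∀ w : W, w.1 ∈ D → Φ w = 0) :
    Module.finrank k F + Module.finrank k D ≤ Module.finrank k W := by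
  have h := LinearMap.finrank_range_add_finrank_ker Φ
  rw [LinearMap.range_eq_top.2 hΦ, finrank_top] at h
  have h' : Module.finrank k (D.submoduleOf W) = Module.finrank k D :=
    (Submodule.submoduleOfEquivOfLe hDW).finrank_eq
  have := Submodule.finrank_mono (show D.submoduleOf W ≤ LinearMap.ker Φ from fun w hw => hD w hw)
  omega

namespace SpansInterval

variable {k : Type u} [Field k] {n : ℕ} {ξ : ZigzagVertex ⥤q Ladder n} {I : LadderInterval n}

/-- The morphism from the constant representation `V_I ∘ ξ` given by a section. -/
def homOfSection (hξ : SpansInterval ξ I) {M : LadderMod k n} {v : ∀ p, M.obj p}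
    (hv : v ∈ sectionSpace (upset ξ) M) :
    Paths.lift ξ ⋙ intervalModule k I ⟶ Paths.lift ξ ⋙ M where
  app x := ConcreteCategory.ofHom
    (LinearMap.toSpanSingleton k (M.obj (ξ.obj x)) (v (ξ.obj x)) ∘ₗ intervalCoord I (ξ.obj x))
  naturality x y f := by
    have key : ∀ (x y : ZigzagVertex) (h : ξ.obj x ≤ ξ.obj y)
        (c : (intervalModule k I).obj (ξ.obj x)),
        intervalCoord I (ξ.obj y) (structMap _ h c) • v (ξ.obj y) =
          structMap M h (intervalCoord I (ξ.obj x) c • v (ξ.obj x)) := by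
      intro x y h c
      rw [intervalCoord_structMap h (hξ.mem y), map_smul, hv.2 _ (obj_mem_upset ξ x)]
    exact FGModuleCat.hom_ext (LinearMap.ext fun c =>
      key x y (leOfHom ((Paths.lift ξ).map f)) c)

/-- The morphism to the constant representation `V_I ∘ ξ` given by a compatible family of
functionals. -/
def homOfFunctionals (I : LadderInterval n) {M : LadderMod k n}
    (φ : ∀ x, M.obj (ξ.obj x) →ₗ[k] k)
    (hI : ∀ x, ξ.obj x ∈ I.1)
    (hφ : ∀ x y (e : x ⟶ y) (m : M.obj (ξ.obj x)),
      φ y (structMap M (leOfHom (ξ.map e)) m) = φ x m) :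
    Paths.lift ξ ⋙ M ⟶ Paths.lift ξ ⋙ intervalModule k I where
  app x := ConcreteCategory.ofHom
    (LinearMap.toSpanSingleton k ((intervalModule k I).obj (ξ.obj x))
      (intervalSection k I (ξ.obj x)) ∘ₗ φ x)
  naturality x y f := by
    have key : ∀ (x y : ZigzagVertex) (f : Quiver.Path x y) (h : ξ.obj x ≤ ξ.obj y)
        (m : M.obj (ξ.obj x)), φ y (structMap M h m) = φ x m := by
      intro x y f
      induction f with
      | nil => exact fun h m => congrArg _ (structMap_refl M m)
      | @cons y z f e ih =>
        intro h m
        have h' : ξ.obj x ≤ ξ.obj y := leOfHom ((Paths.lift ξ).map f)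
        rw [← structMap_trans M h' (leOfHom (ξ.map e)), hφ y z e, ih]
    have key' : ∀ (x y : ZigzagVertex) (f : Quiver.Path x y) (h : ξ.obj x ≤ ξ.obj y)
        (m : M.obj (ξ.obj x)),
        φ y (structMap M h m) • intervalSection k I (ξ.obj y) =
          structMap (intervalModule k I) h (φ x m • intervalSection k I (ξ.obj x)) := by
      intro x y f h m
      rw [key x y f h m, map_smul, (intervalSection_mem I).2 _ (hI x)]
    exact FGModuleCat.hom_ext (LinearMap.ext fun m =>
      key' x y f (leOfHom ((Paths.lift ξ).map f)) m)

/-- The functionals that a morphism to the constant representation consists of. -/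
def functional {M : LadderMod k n} (p : Paths.lift ξ ⋙ M ⟶ Paths.lift ξ ⋙ intervalModule k I)
    (x : ZigzagVertex) : M.obj (ξ.obj x) →ₗ[k] k :=
  intervalCoord I (ξ.obj x) ∘ₗ (p.app x).hom.hom

theorem functional_structMap (hξ : SpansInterval ξ I) {M : LadderMod k n}
    (p : Paths.lift ξ ⋙ M ⟶ Paths.lift ξ ⋙ intervalModule k I) {x y : ZigzagVertex} (e : x ⟶ y)
    (m : M.obj (ξ.obj x)) :
    functional p y (structMap M (leOfHom (ξ.map e)) m) = functional p x m :=
  (congrArg (intervalCoord I (ξ.obj y)) (LinearMap.congr_fun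
    (congrArg (fun g => g.hom.hom) (p.naturality ((Paths.of ZigzagVertex).map e))) m)).trans
    (intervalCoord_structMap (leOfHom (ξ.map e)) (hξ.mem y) ((p.app x).hom.hom m))

/-- The section of `M` along the zigzag that a morphism from the constant representation is. -/
theorem exists_section_of_hom (hξ : SpansInterval ξ I) {M : LadderMod k n}
    (s : Paths.lift ξ ⋙ intervalModule k I ⟶ Paths.lift ξ ⋙ M) :
    ∃ v ∈ sectionSpace (upset ξ) M,
      v (ξ.obj .v2) = (s.app ZigzagVertex.v2).hom.hom (intervalSection k I (ξ.obj .v2)) := by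
  let c : ∀ x : ZigzagVertex, M.obj (ξ.obj x) := fun x =>
    (s.app x).hom.hom (intervalSection k I (ξ.obj x))
  have hc : ∀ (x y : ZigzagVertex) (e : x ⟶ y), structMap M (leOfHom (ξ.map e)) (c x) = c y := by
    intro x y e
    have h : (s.app y).hom.hom (structMap (intervalModule k I) (leOfHom (ξ.map e))
        (intervalSection k I (ξ.obj x))) = structMap M (leOfHom (ξ.map e)) (c x) :=
      LinearMap.congr_fun (congrArg (fun g => g.hom.hom)
        (s.naturality ((Paths.of ZigzagVertex).map e))) (intervalSection k I (ξ.obj x))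
    rw [← h, (intervalSection_mem I).2 _ (hξ.mem x)]
  obtain ⟨v, hv, hv2, -⟩ := hξ.exists_section (c .v2) (c .v4)
    ((hc _ _ ZigzagArrow.a2).trans (hc _ _ ZigzagArrow.a3).symm)
  exact ⟨v, hv, hv2⟩

/-- Copies of the constant representation that split off give sections of `M` that are linearly
independent modulo the dying ones, since a retraction is constant along the zigzag. -/
theorem le_of_isDirectSummand (hξ : SpansInterval ξ I) (M : LadderMod k n) {d : ℕ}
    (hd : IsDirectSummand (⨁ fun _ : Fin d => Paths.lift ξ ⋙ intervalModule k I)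
      (Paths.lift ξ ⋙ M)) :
    d + Module.finrank k (dying ξ M) ≤ Module.finrank k (sectionSpace (upset ξ) M) := by
  classical
  obtain ⟨s, p, hsp⟩ := isDirectSummand_biproduct_iff.1 hd
  choose v hv hv2 using fun i => hξ.exists_section_of_hom (s i)
  let Φ : sectionSpace (upset ξ) M →ₗ[k] (Fin d → k) :=
    LinearMap.pi fun j => functional (p j) .v2 ∘ₗ LinearMap.proj (ξ.obj .v2) ∘ₗ Submodule.subtype _
  have hΦ : ∀ w j, Φ w j = functional (p j) .v2 (w.1 (ξ.obj .v2)) := fun _ _ => rfl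
  have hΦv : ∀ i, Φ ⟨v i, hv i⟩ = Pi.single i 1 := by
    intro i
    funext j
    rw [hΦ]
    change functional (p j) .v2 (v i (ξ.obj .v2)) = _
    rw [hv2]
    have h : functional (p j) .v2 ((s i).app ZigzagVertex.v2 |>.hom.hom
        (intervalSection k I (ξ.obj .v2))) = intervalCoord I (ξ.obj .v2)
          (((s i ≫ p j).app ZigzagVertex.v2).hom.hom (intervalSection k I (ξ.obj .v2))) := rfl
    rw [h, hsp]
    by_cases hij : i = j
    · subst hij
      rw [if_pos rfl, Pi.single_eq_same]
      exact intervalCoord_intervalSection (hξ.mem _)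
    · rw [if_neg hij, Pi.single_eq_of_ne (Ne.symm hij)]
      exact map_zero _
  have hcompat : ∀ (j) (w : sectionSpace (upset ξ) M) {x y : ZigzagVertex} (e : x ⟶ y),
      functional (p j) y (w.1 (ξ.obj y)) = functional (p j) x (w.1 (ξ.obj x)) := by
    intro j w x y e
    rw [← hξ.functional_structMap (p j) e, w.2.2 _ (obj_mem_upset ξ _)]
  have hsurj : Function.Surjective Φ := by
    rw [← LinearMap.range_eq_top, eq_top_iff, ← (Pi.basisFun k (Fin d)).span_eq,
      Submodule.span_le]
    rintro _ ⟨i, rfl⟩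
    exact ⟨_, (hΦv i).trans (Pi.basisFun_apply k _ i).symm⟩
  have key := finrank_add_le_of_surjective (dying_le M) Φ hsurj ?_
  · rwa [Module.finrank_fin_fun] at key
  · rintro ⟨w, hw⟩ hwD
    obtain ⟨a, ha, b, hb, rfl⟩ := Submodule.mem_sup.1 hwD
    rw [mem_vanishing] at ha hb
    have h : (⟨a + b, hw⟩ : sectionSpace (upset ξ) M) = ⟨a, ha.1⟩ + ⟨b, hb.1⟩ := rfl
    rw [h, map_add]
    have h1 : Φ ⟨a, ha.1⟩ = 0 := by
      funext j
      rw [hΦ, ← hcompat j _ ZigzagArrow.a1]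
      exact (congrArg _ (ha.2 _ rfl)).trans (map_zero _)
    have h5 : Φ ⟨b, hb.1⟩ = 0 := by
      funext j
      rw [hΦ, ← hcompat j _ ZigzagArrow.a2, hcompat j _ ZigzagArrow.a3,
        ← hcompat j _ ZigzagArrow.a4]
      exact (congrArg _ (hb.2 _ rfl)).trans (map_zero _)
    rw [h1, h5, add_zero]

/-- Conversely, a basis of the sections modulo the dying ones and its dual basis give the
inclusion and the retraction of copies of the constant representation. -/
theorem isDirectSummand_biproduct (hξ : SpansInterval ξ I) (M : LadderMod k n) {d : ℕ}
    (hd : d + Module.finrank k (dying ξ M) = Module.finrank k (sectionSpace (upset ξ) M)) :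
    IsDirectSummand (⨁ fun _ : Fin d => Paths.lift ξ ⋙ intervalModule k I)
      (Paths.lift ξ ⋙ M) := by
  classical
  let L := Paths.lift ξ ⋙ intervalModule k I
  let W := sectionSpace (upset ξ) M
  let D := (dying ξ M).submoduleOf W
  have hfin : Module.finrank k (W ⧸ D) = d := by
    have h : Module.finrank k (W ⧸ D) + Module.finrank k D =
        Module.finrank k (sectionSpace (upset ξ) M) := D.finrank_quotient_add_finrank
    have h' : Module.finrank k D = Module.finrank k (dying ξ M) :=
      (Submodule.submoduleOfEquivOfLe (dying_le M)).finrank_eq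
    omega
  let b : Module.Basis (Fin d) k (W ⧸ D) := Module.finBasisOfFinrankEq k _ hfin
  choose v hv using fun i => D.mkQ_surjective (b i)
  let g : Fin d → W →ₗ[k] k := fun j => b.coord j ∘ₗ D.mkQ
  have hg : ∀ j (w : W), w.1 ∈ dying ξ M → g j w = 0 := by
    intro j w hw
    have : D.mkQ w = 0 := (Submodule.Quotient.mk_eq_zero D).2 hw
    simp only [g, LinearMap.comp_apply, this, map_zero]
  choose φ hφ hφg using fun j => hξ.exists_functionals M (g j) (hg j)
  let s : ∀ _ : Fin d, L ⟶ Paths.lift ξ ⋙ M := fun i => hξ.homOfSection (v i).2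
  let p : ∀ _ : Fin d, Paths.lift ξ ⋙ M ⟶ L := fun j => homOfFunctionals I (φ j) hξ.mem (hφ j)
  refine isDirectSummand_biproduct_iff.2 ⟨s, p, fun i j => ?_⟩
  have hgv : g j (v i) = if i = j then 1 else 0 := by
    simp only [g, LinearMap.comp_apply, hv, Module.Basis.coord_apply, Module.Basis.repr_self]
    exact Finsupp.single_apply
  have key : ∀ (x : ZigzagVertex) (c : (intervalModule k I).obj (ξ.obj x)),
      φ j x (intervalCoord I (ξ.obj x) c • (v i).1 (ξ.obj x)) • intervalSection k I (ξ.obj x) =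
        (if i = j then (1 : k) else 0) • c := by
    intro x c
    refine intervalCoord_injective I (ξ.obj x) ?_
    rw [map_smul, map_smul, map_smul, hφg, hgv, intervalCoord_intervalSection (hξ.mem x)]
    simp [mul_comm]
  refine NatTrans.ext (funext fun x => FGModuleCat.hom_ext (LinearMap.ext fun c => ?_))
  refine (key x c).trans ?_
  split_ifs
  · exact one_smul _ _
  · exact zero_smul _ _

/-- The multiplicity of the constant representation in the restriction of `M` along `ξ` is the
rank of the map from the limit to the colimit of this restriction. -/
theorem summandMult_add_finrank (hξ : SpansInterval ξ I) (M : LadderMod k n) :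
    summandMult (Paths.lift ξ ⋙ intervalModule k I) (Paths.lift ξ ⋙ M) +
      Module.finrank k (dying ξ M) = Module.finrank k (sectionSpace (upset ξ) M) := by
  obtain ⟨d, hd⟩ := Nat.exists_eq_add_of_le' (Submodule.finrank_mono (dying_le (ξ := ξ) M))
  have h : IsGreatest {d | IsDirectSummand (⨁ fun _ : Fin d => Paths.lift ξ ⋙ intervalModule k I)
      (Paths.lift ξ ⋙ M)} d := by
    refine ⟨hξ.isDirectSummand_biproduct M hd.symm, fun d' hd' => ?_⟩
    have := hξ.le_of_isDirectSummand M hd'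
    omega
  rw [summandMult, h.csSup_eq, hd]

end SpansInterval

/-! ### Compressed multiplicities of interval modules -/

section Compressed

variable {k : Type u} [Field k] {n : ℕ}

namespace SpansInterval

variable {ξ : ZigzagVertex ⥤q Ladder n} {I : LadderInterval n}

open Classical in
/-- For `M = V_K` the sections modulo the dying ones are `k` if `I ⊆ K`, and `0` otherwise. -/
theorem finrank_sectionSpace_intervalModule (hξ : SpansInterval ξ I) (K : LadderInterval n) :
    Module.finrank k (sectionSpace (upset ξ) (intervalModule k K)) =
      (if I ≤ K then 1 else 0) + Module.finrank k (dying ξ (intervalModule k K)) := by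
  have hmap : ∀ v ∈ sectionSpace (upset ξ) (intervalModule k K), ∀ (x y : ZigzagVertex)
      (h : ξ.obj x ≤ ξ.obj y), v (ξ.obj x) = 0 → v (ξ.obj y) = 0 := by
    intro v hv x y h h0
    rw [← hv.2 _ (obj_mem_upset ξ x) _ h, h0, map_zero]
  split_ifs with hIK
  · have hK : ∀ x, ξ.obj x ∈ K.1 := fun x => hIK (hξ.mem x)
    let Φ : sectionSpace (upset ξ) (intervalModule k K) →ₗ[k] k :=
      intervalCoord K (ξ.obj .v2) ∘ₗ LinearMap.proj (ξ.obj .v2) ∘ₗ Submodule.subtype _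
    have hΦ : ∀ v (hv : v ∈ sectionSpace (upset ξ) (intervalModule k K)) (x : ZigzagVertex),
        Φ ⟨v, hv⟩ = intervalCoord K (ξ.obj x) (v (ξ.obj x)) := by
      intro v hv
      have hstep : ∀ (x y : ZigzagVertex) (e : x ⟶ y),
          intervalCoord K (ξ.obj y) (v (ξ.obj y)) = intervalCoord K (ξ.obj x) (v (ξ.obj x)) := by
        intro x y e
        rw [← hv.2 _ (obj_mem_upset ξ x) _ (leOfHom (ξ.map e)), intervalCoord_structMap _ (hK y)]
      have e1 := hstep _ _ ZigzagArrow.a1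
      have e2 := hstep _ _ ZigzagArrow.a2
      have e3 := hstep _ _ ZigzagArrow.a3
      have e4 := hstep _ _ ZigzagArrow.a4
      rintro (_ | _ | _ | _ | _)
      exacts [e1.symm, rfl, e2.symm, e2.symm.trans e3, (e2.symm.trans e3).trans e4.symm]
    have hker : ∀ v (hv : v ∈ sectionSpace (upset ξ) (intervalModule k K)) (x : ZigzagVertex),
        Φ ⟨v, hv⟩ = 0 ↔ v (ξ.obj x) = 0 := by
      intro v hv x
      rw [hΦ v hv x]
      exact map_eq_zero_iff _ (intervalCoord_injective K _)
    have hD : ∀ v (hv : v ∈ sectionSpace (upset ξ) (intervalModule k K)),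
        v ∈ dying ξ (intervalModule k K) ↔ Φ ⟨v, hv⟩ = 0 := by
      intro v hv
      constructor
      · intro hvD
        obtain ⟨a, ha, b, hb, rfl⟩ := Submodule.mem_sup.1 hvD
        rw [mem_vanishing] at ha hb
        have h : Φ ⟨a + b, hv⟩ = Φ ⟨a, ha.1⟩ + Φ ⟨b, hb.1⟩ := map_add Φ ⟨a, ha.1⟩ ⟨b, hb.1⟩
        rw [h, (hker a ha.1 .v1).2 (ha.2 _ rfl), (hker b hb.1 .v5).2 (hb.2 _ rfl), add_zero]
      · intro h
        refine Submodule.mem_sup_left (mem_vanishing.2 ⟨hv, ?_⟩)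
        rintro x rfl
        exact (hker v hv .v1).1 h
    obtain ⟨v, hv, hv2, -⟩ := hξ.exists_section (intervalSection k K _) (intervalSection k K _)
      (((intervalSection_mem K).2 _ (hK .v2) _ _).trans
        ((intervalSection_mem K).2 _ (hK .v4) _ _).symm)
    have hone : Φ ⟨v, hv⟩ = 1 := by
      rw [hΦ v hv .v2, hv2, intervalCoord_intervalSection (hK _)]
    have hsurj : Function.Surjective Φ := fun c =>
      ⟨c • ⟨v, hv⟩, by rw [map_smul, hone, smul_eq_mul, mul_one]⟩
    have h := LinearMap.finrank_range_add_finrank_ker Φ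
    have hker' : LinearMap.ker Φ = (dying ξ (intervalModule k K)).submoduleOf _ := by
      ext ⟨w, hw⟩
      exact (hD w hw).symm
    rw [LinearMap.range_eq_top.2 hsurj, finrank_top, Module.finrank_self, hker',
      (Submodule.submoduleOfEquivOfLe (dying_le _)).finrank_eq] at h
    exact h.symm
  · -- some value of `ξ` at `1, 2, 4, 5` is missed by `K`, so all sections vanish at `1` or at `5`
    have hle : sectionSpace (upset ξ) (intervalModule k K) ≤ dying ξ (intervalModule k K) := by
      have h1 : ∀ x, ξ.obj x ≤ ξ.obj .v1 → ξ.obj x ∉ K.1 →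
          sectionSpace (upset ξ) (intervalModule k K) ≤ dying ξ (intervalModule k K) := by
        intro x hx hxK v hv
        refine Submodule.mem_sup_left (mem_vanishing.2 ⟨hv, ?_⟩)
        rintro _ rfl
        exact hmap v hv x _ hx (eq_zero_of_notMem hxK _)
      have h5 : ∀ x, ξ.obj x ≤ ξ.obj .v5 → ξ.obj x ∉ K.1 →
          sectionSpace (upset ξ) (intervalModule k K) ≤ dying ξ (intervalModule k K) := by
        intro x hx hxK v hv
        refine Submodule.mem_sup_right (mem_vanishing.2 ⟨hv, ?_⟩)
        rintro _ rfl
        exact hmap v hv x _ hx (eq_zero_of_notMem hxK _)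
      by_contra hne
      exact hIK (hξ.le K (by_contra fun h => hne (h1 _ le_rfl h))
        (by_contra fun h => hne (h1 _ (le21 ξ) h)) (by_contra fun h => hne (h5 _ (le45 ξ) h))
        (by_contra fun h => hne (h5 _ le_rfl h)))
    rw [zero_add, le_antisymm hle (dying_le _)]

end SpansInterval

open SpansInterval

/-- The compressed multiplicity is an alternating sum of dimensions of spaces of sections over
convex sets. -/
theorem compressedMult_eq (M : LadderMod k n) (I : LadderInterval n) :
    (compressedMult M I : ℤ) = Module.finrank k (sectionSpace (upset (xiMor I)) M) -
      Module.finrank k (vanishing (xiMor I) {.v1} M) -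
      Module.finrank k (vanishing (xiMor I) {.v5} M) +
      Module.finrank k (vanishing (xiMor I) {.v1, .v5} M) := by
  have h : compressedMult M I + _ = _ := (xiMor_spansInterval I).summandMult_add_finrank M
  have h' := finrank_dying_add (ξ := xiMor I) M
  omega

open Classical in
theorem compressedMult_intervalModule (I K : LadderInterval n) :
    compressedMult (intervalModule k K) I = if I ≤ K then 1 else 0 := by
  have h : compressedMult (intervalModule k K) I + _ = _ :=
    (xiMor_spansInterval I).summandMult_add_finrank (intervalModule k K)
  rw [(xiMor_spansInterval I).finrank_sectionSpace_intervalModule] at h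
  omega

open Classical in
/-- The compressed multiplicity is additive on interval resolutions, since it is a combination
of dimensions of spaces of sections over convex sets. -/
theorem IntervalResolution.compressedMult_eq_sum [Fintype (LadderInterval n)] {M : LadderMod k n}
    {r : ℕ} (R : IntervalResolution M r) (I : LadderInterval n) :
    (compressedMult M I : ℤ) = ∑ i ∈ Finset.range (r + 1), (-1 : ℤ) ^ i *
      ∑ K, (R.mult i K : ℤ) * (if I ≤ K then 1 else 0) := by
  have h : ∀ K : LadderInterval n, (if I ≤ K then 1 else 0 : ℤ) =
      (compressedMult (intervalModule k K) I : ℤ) := by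
    intro K
    rw [compressedMult_intervalModule]
    split_ifs <;> rfl
  simp only [h, compressedMult_eq]
  rw [R.finrank_sectionSpace_eq_sum (isUpperSet_upset _).ordConnected,
    R.finrank_sectionSpace_eq_sum (ordConnected_diff _ _),
    R.finrank_sectionSpace_eq_sum (ordConnected_diff _ _),
    R.finrank_sectionSpace_eq_sum (ordConnected_diff _ _)]
  simp only [mul_add, mul_sub, Finset.sum_add_distrib, Finset.sum_sub_distrib]

end Compressed

end

theorem mainTheorem5 {k : Type u} [Field k] (n : ℕ) (M : LadderMod k n) (r : ℕ)
    (R : IntervalResolution M r) (J : LadderInterval n) :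
    (∀ S ⊆ intervalCovers J, S.Nonempty →
      IsLUB (S : Set (LadderInterval n)) (intervalJoin J S)) ∧
    intervalApproximation M J =
      ∑ i ∈ Finset.range (r + 1), (-1 : ℤ) ^ i * (R.mult i J : ℤ) := by
  classical
  refine ⟨fun S hS hne => isLUB_intervalJoin hS hne, ?_⟩
  cases nonempty_fintype (LadderInterval n)
  simp only [intervalApproximation, R.compressedMult_eq_sum, Finset.mul_sum]
  rw [Finset.sum_comm]
  refine Finset.sum_congr rfl fun i _ => ?_
  rw [Finset.sum_comm]
  have h : ∀ K : LadderInterval n, ∑ S ∈ (intervalCovers J).powerset,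
      (-1 : ℤ) ^ S.card * ((-1) ^ i * (R.mult i K * if intervalJoin J S ≤ K then 1 else 0)) =
        (-1) ^ i * R.mult i K * if J = K then 1 else 0 := by
    intro K
    rw [← sum_powerset_intervalCovers, Finset.mul_sum]
    exact Finset.sum_congr rfl fun S _ => by ring
  rw [Finset.sum_congr rfl fun K _ => h K]
  simp
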